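/- Let $\mathcal A,\mathcal X,\mathcal Y$ be non-zero finite-dimensional complex Hilbert spaces of dimensions $d_A,d_X,d_Y$ with fixed orthonormal bases, and let $n\ge 1$. For a linear map $\Phi$ from operators on $\mathcal I$ to operators on $\mathcal O$, its Choi matrix is $(\mathrm{id}_{\mathcal I}\otimes\Phi)(|\Omega\rangle\langle\Omega|)$ with $|\Omega\rangle=(\dim \mathcal I)^{-1/2}\sum_i|i,i\rangle$. Let $\mathbb Q:\mathcal A\otimes\mathcal X^{\otimes n}\to\mathcal Y^{\otimes n}$ be a completely positive trace-preserving (CPTP) map that is - *symmetric*: permuting the input registers $\mathcal X_1,\dots,\mathcal X_n$ amounts to permuting the output registers $\mathcal Y_1,\dots,\mathcal Y_n$ in the same way; - *non-signalling*: for every $i$, the reduced output state $\mathrm{tr}_{\mathcal Y_j,\,j\ne i}[\mathbb Q(\rho)]$ is a function of the reduced input state $\mathrm{tr}_{\mathcal X_j,\,j\neq i}[\rho]$ on $\mathcal A\otimes\mathcal X_i$ only. Let $\omega$ be the Choi matrix of $\mathbb Q$, an operator on $\mathcal A\otimes(\mathcal X\otimes\mathcal Y)^{\otimes n}$ after reordering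 the factors, and let $\omega_{AXY}=\mathrm{tr}_{(\mathcal X\mathcal Y)_{2:n}}[\omega]$ be its reduction to $\mathcal A$ and the first pair. Then there are a measurable space $G$, an operator-valued measure $M(dg)$ on $G$ such that $d_A M(dg)$ is a POVM on $\mathcal A$, and a measurable family of states $\tilde\phi_g$ on $\mathcal X\otimes\mathcal Y$ ($g\in G$) such that $\mathrm{tr}_{\mathcal Y}[\tilde\phi_g]=\mathbb 1_{\mathcal X}/d_X$ for every $g$ (so that each $\tilde\phi_g$ is the Choi matrix of a CPTP map $\mathcal X\to\mathcal Y$), the operator $$\eta_{AXY}=\int_G M(dg)\otimes\tilde\phi_g$$ is a separable quantum state (with respect to $\mathcal A$ versus $\mathcal X\otimes\mathcal Y$), and, in trace norm $\|Z\|_1=\mathrm{tr}\,|Z|$, $$\|\omega_{AXY}-\eta_{AXY}\|_1\le c\,n^{-1/6}+K\,n^{-1/3},$$ where the constants $c$ and $K$ (the latter being the implied constant of the term $O(n^{-1/3})$) depend only on $d_X$ and $d_Y$. -/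

import Mathlib

open scoped ComplexOrder

noncomputable section

namespace QLearn

open MeasureTheory Matrix

/-! Finite-dimensional systems are the Hilbert spaces `ℂ^I` with `I` a finite index type; operators
are matrices, and `I × J` indexes the tensor product of the systems indexed by `I` and `J`. -/

/-- Quantum states: positive semidefinite operators of trace one. -/
def IsState {I : Type*} [Fintype I] (ρ : Matrix I I ℂ) : Prop :=
  ρ.PosSemidef ∧ ρ.trace = 1

/-- The partial trace over the right tensor factor. -/
def trRight {I R : Type*} [Fintype R] (M : Matrix (I × R) (I × R) ℂ) : Matrix I I ℂ :=
  Matrix.of fun i i' => ∑ r, M (i, r) (i', r)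

/-- The trace norm `‖M‖₁ = tr |M| = tr √(Mᴴ M)`, the trace of the square root being the sum of the
square roots of the eigenvalues of `Mᴴ M`. -/
def traceNorm {I : Type*} [Fintype I] [DecidableEq I] (M : Matrix I I ℂ) : ℝ :=
  ∑ i, Real.sqrt ((isHermitian_conjTranspose_mul_self M).eigenvalues i)

/-- The map `id ⊗ Φ`, where the identity acts on an ancilla indexed by `K`. -/
def ampl (K : Type*) {I O : Type*} (Φ : Matrix I I ℂ →ₗ[ℂ] Matrix O O ℂ)
    (ρ : Matrix (K × I) (K × I) ℂ) : Matrix (K × O) (K × O) ℂ :=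
  Matrix.of fun p q => Φ (Matrix.of fun i i' => ρ (p.1, i) (q.1, i')) p.2 q.2

/-- Quantum channels: completely positive and trace-preserving (CPTP) linear maps. -/
structure IsChannel {I O : Type*} [Fintype I] [Fintype O]
    (Φ : Matrix I I ℂ →ₗ[ℂ] Matrix O O ℂ) : Prop where
  completelyPositive : ∀ (k : ℕ) (ρ : Matrix (Fin k × I) (Fin k × I) ℂ),
    ρ.PosSemidef → (ampl (Fin k) Φ ρ).PosSemidef
  tracePreserving : ∀ ρ : Matrix I I ℂ, (Φ ρ).trace = ρ.trace

/-- The projector `|Ω⟩⟨Ω|` on the maximally entangled vector `|Ω⟩ = d^{-1/2} ∑ᵢ |i, i⟩`. -/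
def maxEntangled (I : Type*) [Fintype I] [DecidableEq I] : Matrix (I × I) (I × I) ℂ :=
  Matrix.of fun p q => if p.1 = p.2 ∧ q.1 = q.2 then (Fintype.card I : ℂ)⁻¹ else 0

/-- The Choi matrix `(id ⊗ Φ)(|Ω⟩⟨Ω|)` of a linear map. -/
def choi {I O : Type*} [Fintype I] [DecidableEq I] (Φ : Matrix I I ℂ →ₗ[ℂ] Matrix O O ℂ) :
    Matrix (I × O) (I × O) ℂ :=
  ampl I Φ (maxEntangled I)

theorem choi_apply {I O : Type*} [Fintype I] [DecidableEq I]
    (Φ : Matrix I I ℂ →ₗ[ℂ] Matrix O O ℂ) (p q : I × O) :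
    choi Φ p q = (Fintype.card I : ℂ)⁻¹ * Φ (Matrix.single p.1 q.1 1) p.2 q.2 := by
  have h : (Matrix.of fun k k' => maxEntangled I (p.1, k) (q.1, k')) =
      (Fintype.card I : ℂ)⁻¹ • Matrix.single p.1 q.1 (1 : ℂ) := by
    ext k k'
    simp [maxEntangled, Matrix.single, Matrix.of_apply]
  simp only [choi, ampl, Matrix.of_apply, h, map_smul, Matrix.smul_apply, smul_eq_mul]

section Registers

variable {n : ℕ} {A X Y : Type*}

/-- The basis index of `n` registers with `x` at register `i` and `u` at the other ones. -/
def ins (i : Fin n) (x : X) (u : {j : Fin n // j ≠ i} → X) : Fin n → X :=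
  (Equiv.funSplitAt i X).symm (x, u)

/-- The partial trace over all output registers but the `i`-th one. -/
def keepY [Fintype Y] (i : Fin n) (M : Matrix (Fin n → Y) (Fin n → Y) ℂ) : Matrix Y Y ℂ :=
  Matrix.of fun y y' => ∑ v : {j : Fin n // j ≠ i} → Y, M (ins i y v) (ins i y' v)

/-- The partial trace over all input registers but the `i`-th one (and `A`, which is kept). -/
def keepAX [Fintype X] (i : Fin n) (ρ : Matrix (A × (Fin n → X)) (A × (Fin n → X)) ℂ) :
    Matrix (A × X) (A × X) ℂ :=
  Matrix.of fun p q =>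
    ∑ u : {j : Fin n // j ≠ i} → X, ρ (p.1, ins i p.2 u) (q.1, ins i q.2 u)

/-- The reduction `ω_{A X_i Y_i}` of an operator `ω` on `A X₁ ⋯ X_n Y₁ ⋯ Y_n`: the partial trace
over all pairs `X_j Y_j` with `j ≠ i`. -/
def keepAXY [Fintype X] [Fintype Y] (i : Fin n)
    (ω : Matrix ((A × (Fin n → X)) × (Fin n → Y)) ((A × (Fin n → X)) × (Fin n → Y)) ℂ) :
    Matrix (A × (X × Y)) (A × (X × Y)) ℂ :=
  Matrix.of fun p q =>
    ∑ u : {j : Fin n // j ≠ i} → X, ∑ v : {j : Fin n // j ≠ i} → Y,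
      ω ((p.1, ins i p.2.1 u), ins i p.2.2 v) ((q.1, ins i q.2.1 u), ins i q.2.2 v)

/-- `Q` is non-signalling: for every `i`, the reduced output state at register `i` is a function
of the reduced input state on `A X_i` only. -/
def IsNonSignalling [Fintype A] [Fintype X] [Fintype Y]
    (Q : Matrix (A × (Fin n → X)) (A × (Fin n → X)) ℂ →ₗ[ℂ]
      Matrix (Fin n → Y) (Fin n → Y) ℂ) : Prop :=
  ∀ (i : Fin n) (ρ σ : Matrix (A × (Fin n → X)) (A × (Fin n → X)) ℂ),
    IsState ρ → IsState σ → keepAX i ρ = keepAX i σ → keepY i (Q ρ) = keepY i (Q σ)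

/-- `Q` is symmetric: permuting the input registers amounts to permuting the output registers in
the same way. -/
def IsSymmetricMap
    (Q : Matrix (A × (Fin n → X)) (A × (Fin n → X)) ℂ →ₗ[ℂ]
      Matrix (Fin n → Y) (Fin n → Y) ℂ) : Prop :=
  ∀ (s : Equiv.Perm (Fin n)) (ρ : Matrix (A × (Fin n → X)) (A × (Fin n → X)) ℂ),
    Q (ρ.submatrix (fun p => (p.1, p.2 ∘ s)) (fun p => (p.1, p.2 ∘ s))) =
      (Q ρ).submatrix (fun y => y ∘ s) (fun y => y ∘ s)

end Registers

/-- Positive operator-valued measures (POVMs): countably additive, with positive semidefinite values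
and total mass the identity. -/
structure IsPOVM {G A : Type*} [MeasurableSpace G] [Fintype A] [DecidableEq A]
    (N : VectorMeasure G (Matrix A A ℂ)) : Prop where
  posSemidef : ∀ E : Set G, MeasurableSet E → (N E).PosSemidef
  univ : N Set.univ = 1

/-- The matrix entry `E ↦ M(E)_{a a'}` of an operator-valued measure, a complex measure. -/
def entry {G A : Type*} [MeasurableSpace G] (M : VectorMeasure G (Matrix A A ℂ)) (a a' : A) :
    ComplexMeasure G :=
  M.mapRange (Matrix.entryAddMonoidHom ℂ a a') (continuous_id.matrix_elem a a')

theorem entry_apply {G A : Type*} [MeasurableSpace G] (M : VectorMeasure G (Matrix A A ℂ)) (a a' : A)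
    (E : Set G) : entry M a a' E = M E a a' :=
  rfl

/-- The operator `∫ M(dg) ⊗ φ_g`: its matrix entries are the integrals of the entries of `φ_g`
against the entries of the operator-valued measure `M`. -/
def tensorIntegral {G A B : Type*} [MeasurableSpace G] (M : VectorMeasure G (Matrix A A ℂ))
    (φ : G → Matrix B B ℂ) : Matrix (A × B) (A × B) ℂ :=
  Matrix.of fun p q =>
    (entry M p.1 q.1).integral (fun g => φ g p.2 q.2) (ContinuousLinearMap.mul ℝ ℂ)

/-- Separable states of a bipartite system: the convex hull of the product states. -/
def IsSeparableState {A B : Type*} [Fintype A] [Fintype B]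
    (η : Matrix (A × B) (A × B) ℂ) : Prop :=
  η ∈ convexHull ℝ {ξ : Matrix (A × B) (A × B) ℂ | ∃ (ρ : Matrix A A ℂ) (σ : Matrix B B ℂ),
    IsState ρ ∧ IsState σ ∧ ξ = Matrix.kroneckerMap (fun x y => x * y) ρ σ}

end QLearn

end

open scoped ComplexOrder

namespace QLearn

open Matrix MeasureTheory

/-! The Choi matrix of `Q` is a permutation-invariant operator `ω` on `A` and the `n` pairs `XY`,
and trace preservation makes its marginal on `A X₁ ⋯ X_n` maximally mixed. The theorem is then a
finite de Finetti theorem, proved by local tomography.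

Fix an informationally complete POVM `E` on `XY` with a Hermitian dual frame `D`, so that `R = ∑ z,
tr(E z R) D z`. Measure every register with `E`, and split the registers into two blocks `S` and
`T`. For outcomes `u` on `S`, let `M u` be the unnormalized operator left on `A`; these operators
sum to `1 / d_A`. By symmetry the reduced state equals `∑ u, M u ⊗ dualMean D u` exactly (`hlhs` in
`exists_deFinetti`).

The empirical mean `dualMean D u` is Hermitian but need not be a state or have the right marginal,
so it is replaced twice. First, the conditional mean of `dualMean D w` over the outcomes `w` on `T`,
given `u`, is a genuine state `τ u` (`exists_isState_conditional`). Exchangeability gives all pairs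
of registers the same correlation, so the two empirical means differ by `O(1/|S| + 1/|T|)` in mean
square (`sum_mul_norm_sum_sq_le`). Second, the entries of `tr_Y D - 1/d_X` at distinct registers are
uncorrelated because the `X` marginal is a product. Hence `tr_Y τ u` is close to `1/d_X`, and
`exists_state_trRight_eq` repairs it at a proportional cost.

Changing the factor beside a positive `M u` costs `tr (M u)` times the change on `XY`, so `d_A`
never enters. Halving the registers gives an error of order `n^(-1/2)`, which is stronger than the
stated rate. -/

/-! ### Trace-norm bounds from positive decompositions -/

/-- `H` is a difference of positive semidefinite matrices of total trace at most `c`. -/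
def TraceBounded {I : Type*} [Fintype I] (H : Matrix I I ℂ) (c : ℝ) : Prop :=
  ∃ P N : Matrix I I ℂ, P.PosSemidef ∧ N.PosSemidef ∧ H = P - N ∧ (P.trace + N.trace).re ≤ c

/-- The two eigenvalue families are compared as multisets of roots of the characteristic polynomial
of `Hᴴ * H`, since their enumerations need not agree. -/
theorem traceNorm_eq_sum_abs_eigenvalues {I : Type*} [Fintype I] [DecidableEq I]
    {H : Matrix I I ℂ} (hH : H.IsHermitian) : traceNorm H = ∑ i, |hH.eigenvalues i| := by
  have key : Multiset.map (isHermitian_conjTranspose_mul_self H).eigenvalues Finset.univ.val =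
      Multiset.map (fun i => (hH.eigenvalues i) ^ 2) Finset.univ.val := by
    have h1 := (isHermitian_conjTranspose_mul_self H).roots_charpoly_eq_eigenvalues
    have h2 : (Hᴴ * H).charpoly =
        ∏ i, (Polynomial.X - Polynomial.C (((hH.eigenvalues i) ^ 2 : ℝ) : ℂ)) := by
      rw [hH.eq]
      conv_lhs => rw [hH.spectral_theorem, ← map_mul, diagonal_mul_diagonal,
        Unitary.conjStarAlgAut_apply, charpoly_mul_comm, ← mul_assoc]
      simp [charpoly_diagonal, pow_two]
    rw [h2, Polynomial.roots_prod _ _ (by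
      exact Finset.prod_ne_zero_iff.2 fun i _ => Polynomial.X_sub_C_ne_zero _)] at h1
    have h3 := congrArg (Multiset.map Complex.re) h1
    simp only [Polynomial.roots_X_sub_C, Multiset.map_map] at h3
    simp only [Multiset.bind_singleton, Multiset.map_map] at h3
    exact h3.symm
  have h := congrArg (fun s => (Multiset.map Real.sqrt s).sum) key
  simp only [Multiset.map_map] at h
  have h' : ∑ i, Real.sqrt ((isHermitian_conjTranspose_mul_self H).eigenvalues i) =
      ∑ i, Real.sqrt ((hH.eigenvalues i) ^ 2) := h
  simpa [traceNorm, Real.sqrt_sq_eq_abs] using h'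

/-- In an eigenbasis of `P - N`, each eigenvalue is a difference of nonnegative diagonal entries of
`P` and `N`, and the change of basis preserves both traces. -/
theorem traceNorm_le_of_traceBounded {I : Type*} [Fintype I] [DecidableEq I]
    {H : Matrix I I ℂ} {c : ℝ} (h : TraceBounded H c) : traceNorm H ≤ c := by
  obtain ⟨P, N, hP, hN, rfl, hc⟩ := h
  have hH : (P - N).IsHermitian := hP.1.sub hN.1
  rw [traceNorm_eq_sum_abs_eigenvalues hH]
  set U : Matrix I I ℂ := (hH.eigenvectorUnitary : Matrix I I ℂ) with hU
  have hUU : U * Uᴴ = 1 := by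
    have := hH.eigenvectorUnitary.2
    exact (mem_unitaryGroup_iff.1 this)
  have hd : ∀ i, ((hH.eigenvalues i : ℝ) : ℂ) = (Uᴴ * P * U) i i - (Uᴴ * N * U) i i := by
    intro i
    have h1 := hH.conjStarAlgAut_star_eigenvectorUnitary
    rw [Unitary.conjStarAlgAut_apply] at h1
    have h2 := congrFun (congrFun h1 i) i
    simp only [diagonal_apply_eq, Function.comp_apply] at h2
    have h3 : (Uᴴ * (P - N) * U) i i = ((hH.eigenvalues i : ℝ) : ℂ) := by
      simpa [hU, star_eq_conjTranspose] using h2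
    rw [← h3, mul_sub, sub_mul, Matrix.sub_apply]
  have hP' := hP.conjTranspose_mul_mul_same U
  have hN' := hN.conjTranspose_mul_mul_same U
  have ht : ∀ R : Matrix I I ℂ, (Uᴴ * R * U).trace = R.trace := by
    intro R
    rw [Matrix.mul_assoc, trace_mul_comm, Matrix.mul_assoc, hUU, Matrix.mul_one]
  have hle : ∀ i, |hH.eigenvalues i| ≤ ((Uᴴ * P * U) i i).re + ((Uᴴ * N * U) i i).re := by
    intro i
    have h1 := (Complex.le_def.1 (hP'.diag_nonneg (i := i))).1
    have h2 := (Complex.le_def.1 (hN'.diag_nonneg (i := i))).1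
    have h3 := congrArg Complex.re (hd i)
    simp only [Complex.ofReal_re, Complex.sub_re, Complex.zero_re] at h1 h2 h3
    rw [h3, abs_le]
    constructor <;> linarith
  calc _ ≤ ∑ i, (((Uᴴ * P * U) i i).re + ((Uᴴ * N * U) i i).re) :=
        Finset.sum_le_sum fun i _ => hle i
    _ = ((Uᴴ * P * U).trace + (Uᴴ * N * U).trace).re := by
        simp [Finset.sum_add_distrib, trace]
    _ ≤ c := by rw [ht, ht]; exact hc

theorem TraceBounded.mono {I : Type*} [Fintype I] {H : Matrix I I ℂ} {c d : ℝ}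
    (h : TraceBounded H c) (hcd : c ≤ d) : TraceBounded H d := by
  obtain ⟨P, N, hP, hN, e, hc⟩ := h
  exact ⟨P, N, hP, hN, e, hc.trans hcd⟩

theorem TraceBounded.zero {I : Type*} [Fintype I] : TraceBounded (0 : Matrix I I ℂ) 0 :=
  ⟨0, 0, .zero, .zero, by simp, by simp⟩

theorem TraceBounded.add {I : Type*} [Fintype I] {H H' : Matrix I I ℂ} {c c' : ℝ}
    (h : TraceBounded H c) (h' : TraceBounded H' c') : TraceBounded (H + H') (c + c') := by
  obtain ⟨P, N, hP, hN, rfl, hc⟩ := h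
  obtain ⟨P', N', hP', hN', rfl, hc'⟩ := h'
  refine ⟨P + P', N + N', hP.add hP', hN.add hN', by abel, ?_⟩
  simp only [trace_add, Complex.add_re] at hc hc' ⊢
  linarith

theorem TraceBounded.sum {I ι : Type*} [Fintype I] (s : Finset ι) {H : ι → Matrix I I ℂ}
    {c : ι → ℝ} (h : ∀ i ∈ s, TraceBounded (H i) (c i)) :
    TraceBounded (∑ i ∈ s, H i) (∑ i ∈ s, c i) := by
  classical
  induction s using Finset.induction_on with
  | empty => simpa using TraceBounded.zero
  | insert a s ha ih =>
    rw [Finset.sum_insert ha, Finset.sum_insert ha]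
    exact (h a (by simp)).add (ih fun i hi => h i (by simp [hi]))

/-- The positive factor enters through its trace alone; this keeps the dimension of `A` out of the
constants. -/
theorem TraceBounded.kronecker {A B : Type*} [Fintype A] [Fintype B] {M : Matrix A A ℂ}
    {H : Matrix B B ℂ} {c : ℝ} (hM : M.PosSemidef) (h : TraceBounded H c) :
    TraceBounded (kroneckerMap (fun x y => x * y) M H) (M.trace.re * c) := by
  obtain ⟨P, N, hP, hN, rfl, hc⟩ := h
  refine ⟨_, _, hM.kronecker hP, hM.kronecker hN, ?_, ?_⟩
  · ext p q
    simp [kroneckerMap_apply, mul_sub]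
  · have hM0 := Complex.le_def.1 hM.trace_nonneg
    simp only [Complex.zero_re, Complex.zero_im] at hM0
    rw [trace_kronecker, trace_kronecker, ← mul_add, Complex.mul_re, ← hM0.2, zero_mul, sub_zero]
    exact mul_le_mul_of_nonneg_left hc hM0.1

theorem IsState.traceBounded_sub {I : Type*} [Fintype I] {ρ σ : Matrix I I ℂ}
    (hρ : IsState ρ) (hσ : IsState σ) : TraceBounded (ρ - σ) 2 :=
  ⟨ρ, σ, hρ.1, hσ.1, rfl, by rw [hρ.2, hσ.2]; norm_num⟩

/-- Cauchy–Schwarz: the Hilbert–Schmidt norm dominates the quadratic form. -/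
theorem norm_dotProduct_mulVec_sq_le {I : Type*} [Fintype I] (H : Matrix I I ℂ) (x : I → ℂ) :
    ‖star x ⬝ᵥ (H *ᵥ x)‖ ^ 2 ≤ (∑ i, ∑ j, ‖H i j‖ ^ 2) * (∑ i, ‖x i‖ ^ 2) ^ 2 := by
  have h1 : ‖star x ⬝ᵥ (H *ᵥ x)‖ ≤ ∑ p : I × I, ‖H p.1 p.2‖ * (‖x p.1‖ * ‖x p.2‖) := by
    simp only [dotProduct, mulVec, Finset.mul_sum]
    rw [← Fintype.sum_prod_type' (f := fun i j => star x i * (H i j * x j))]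
    refine (norm_sum_le _ _).trans (Finset.sum_le_sum fun p _ => le_of_eq ?_)
    simp
    ring
  calc _ ≤ (∑ p : I × I, ‖H p.1 p.2‖ * (‖x p.1‖ * ‖x p.2‖)) ^ 2 := by gcongr
    _ ≤ (∑ p : I × I, ‖H p.1 p.2‖ ^ 2) * ∑ p : I × I, (‖x p.1‖ * ‖x p.2‖) ^ 2 :=
        Finset.sum_mul_sq_le_sq_mul_sq _ _ _
    _ = _ := by
        rw [Fintype.sum_prod_type, Fintype.sum_prod_type]
        congr 1
        rw [pow_two (∑ i, ‖x i‖ ^ 2), Finset.sum_mul_sum]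
        simp [mul_pow]

theorem posSemidef_smul_one_add {I : Type*} [Fintype I] [DecidableEq I] {H : Matrix I I ℂ}
    (hH : H.IsHermitian) {δ : ℝ} (h0 : 0 ≤ δ) (hδ : ∑ i, ∑ j, ‖H i j‖ ^ 2 ≤ δ ^ 2) :
    ((δ : ℂ) • (1 : Matrix I I ℂ) + H).PosSemidef := by
  have hherm : ((δ : ℂ) • (1 : Matrix I I ℂ) + H).IsHermitian := by
    refine IsHermitian.add ?_ hH
    simp [IsHermitian, conjTranspose_smul]
  refine PosSemidef.of_dotProduct_mulVec_nonneg hherm fun x => ?_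
  have him := hH.im_star_dotProduct_mulVec_self x
  have hx : star x ⬝ᵥ x = ((∑ i, ‖x i‖ ^ 2 : ℝ) : ℂ) := by
    simp [dotProduct, Complex.conj_mul']
  have hn : ‖star x ⬝ᵥ (H *ᵥ x)‖ ≤ δ * ∑ i, ‖x i‖ ^ 2 := by
    refine abs_le_of_sq_le_sq' ?_ (by positivity) |>.2
    refine (norm_dotProduct_mulVec_sq_le H x).trans ?_
    rw [mul_pow]
    gcongr
  rw [add_mulVec, dotProduct_add, smul_mulVec, one_mulVec, dotProduct_smul, hx, Complex.le_def]
  have := (abs_le.1 ((Complex.abs_re_le_norm _).trans hn)).1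
  simp only [RCLike.im_to_complex] at him
  constructor
  · simp [-Complex.ofReal_sum] at this ⊢
    linarith
  · simp [-Complex.ofReal_sum, him]

/-- Write `H = (δ + H)/2 - (δ - H)/2`. This converts entrywise mean-square estimates into trace-norm
estimates, at the price of a dimension factor. -/
theorem traceBounded_of_sum_sq_le {I : Type*} [Fintype I] [DecidableEq I] {H : Matrix I I ℂ}
    (hH : H.IsHermitian) {δ : ℝ} (h0 : 0 ≤ δ) (hδ : ∑ i, ∑ j, ‖H i j‖ ^ 2 ≤ δ ^ 2) :
    TraceBounded H (Fintype.card I * δ) := by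
  have h1 := posSemidef_smul_one_add hH h0 hδ
  have h2 := posSemidef_smul_one_add hH.neg h0 (by simpa using hδ)
  have h2' : (0 : ℂ) ≤ 1 / 2 := by
    rw [Complex.le_def]; norm_num
  refine ⟨_, _, h1.smul h2', h2.smul h2', ?_, le_of_eq ?_⟩
  · ext i j
    simp
    ring
  · rw [← trace_add, ← smul_add]
    have : (δ : ℂ) • (1 : Matrix I I ℂ) + H + ((δ : ℂ) • (1 : Matrix I I ℂ) + -H) =
      (2 : ℂ) • (δ : ℂ) • (1 : Matrix I I ℂ) := by rw [two_smul]; abel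
    rw [this, smul_smul]
    simp [trace_smul, mul_comm]

/-! ### Positivity of partial sums and partial traces -/

theorem posSemidef_sum_contract {I R : Type*} [Fintype I] [Fintype R]
    {M : Matrix (I × R) (I × R) ℂ} (hM : M.PosSemidef) :
    (Matrix.of fun i i' => ∑ r, ∑ r', M (i, r) (i', r')).PosSemidef := by
  classical
  -- The contraction is `Vᴴ M V`, where `V` sends the basis vector `i` to the sum of all `(i, r)`.
  have h := hM.conjTranspose_mul_mul_same
    (Matrix.of fun (p : I × R) (i : I) => if p.1 = i then (1 : ℂ) else 0)
  convert h using 1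
  ext i i'
  simp only [Matrix.mul_apply, conjTranspose_apply, of_apply, Fintype.sum_prod_type]
  simp [apply_ite, Finset.sum_ite_irrel]
  rw [Finset.sum_comm]

theorem posSemidef_trRight {I R : Type*} [Fintype R]
    {M : Matrix (I × R) (I × R) ℂ} (hM : M.PosSemidef) : (trRight M).PosSemidef := by
  have : trRight M = ∑ r, M.submatrix (fun i => (i, r)) (fun i => (i, r)) := by
    ext i i'
    simp [trRight, Matrix.sum_apply]
  rw [this]
  exact posSemidef_sum _ fun r _ => hM.submatrix _

/-! ### Finitely supported operator-valued measures and separability -/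

/-- The operator-valued measure with mass `M i` at each point `i` of a finite set. -/
noncomputable def sumDirac {ι A : Type*} [Fintype ι] [MeasurableSpace ι]
    (M : ι → Matrix A A ℂ) : VectorMeasure ι (Matrix A A ℂ) :=
  ∑ i, VectorMeasure.dirac i (M i)

open Classical in
theorem sumDirac_apply {ι A : Type*} [Fintype ι] [MeasurableSpace ι]
    (M : ι → Matrix A A ℂ) {E : Set ι} (hE : MeasurableSet E) :
    sumDirac M E = ∑ i, if i ∈ E then M i else 0 := by
  rw [sumDirac, FunLike.coe_sum, Finset.sum_apply]
  refine Finset.sum_congr rfl fun i _ => ?_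
  by_cases h : i ∈ E <;> simp [h, hE]

theorem entry_sumDirac {ι A : Type*} [Fintype ι] [MeasurableSpace ι]
    (M : ι → Matrix A A ℂ) (a a' : A) :
    entry (sumDirac M) a a' = ∑ i, VectorMeasure.dirac i (M i a a') := by
  classical
  ext E hE
  rw [entry_apply, sumDirac_apply _ hE, FunLike.coe_sum, Finset.sum_apply, Matrix.sum_apply]
  refine Finset.sum_congr rfl fun i _ => ?_
  by_cases h : i ∈ E <;> simp [h, hE]

theorem tensorIntegral_sumDirac {ι A B : Type*} [Fintype ι] [MeasurableSpace ι]
    [DiscreteMeasurableSpace ι] (M : ι → Matrix A A ℂ) (φ : ι → Matrix B B ℂ) :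
    tensorIntegral (sumDirac M) φ = ∑ i, kroneckerMap (fun x y => x * y) (M i) (φ i) := by
  ext p q
  rw [tensorIntegral, of_apply, entry_sumDirac, VectorMeasure.integral_finsetSum_vectorMeasure,
    Matrix.sum_apply]
  · refine Finset.sum_congr rfl fun i _ => ?_
    rw [VectorMeasure.integral_dirac]
    simp [mul_comm]
  · intro i _
    exact Integrable.of_finite

theorem isPOVM_sumDirac {ι A : Type*} [Fintype ι] [MeasurableSpace ι]
    [Fintype A] [DecidableEq A] {M : ι → Matrix A A ℂ} (hM : ∀ i, (M i).PosSemidef)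
    {c : ℂ} (hc : 0 ≤ c) (h1 : c • ∑ i, M i = 1) :
    IsPOVM (c • sumDirac M) := by
  classical
  constructor
  · intro E hE
    rw [_root_.smul_apply, sumDirac_apply _ hE]
    refine PosSemidef.smul (posSemidef_sum _ fun i _ => ?_) hc
    split_ifs
    exacts [hM i, .zero]
  · rw [_root_.smul_apply, sumDirac_apply _ .univ]
    simpa using h1

theorem exists_isState (I : Type*) [Fintype I] [DecidableEq I] [Nonempty I] :
    ∃ ρ : Matrix I I ℂ, IsState ρ := by
  refine ⟨(Fintype.card I : ℂ)⁻¹ • 1, PosSemidef.one.smul (by positivity), ?_⟩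
  simp [trace_smul]

theorem PosSemidef.exists_isState_smul {I : Type*} [Fintype I] [Nonempty I] {M : Matrix I I ℂ}
    (hM : M.PosSemidef) : ∃ ρ, IsState ρ ∧ M = (M.trace.re : ℂ) • ρ := by
  classical
  have h0 := Complex.le_def.1 hM.trace_nonneg
  have hre : ((M.trace.re : ℝ) : ℂ) = M.trace := Complex.ext rfl (by simpa using h0.2)
  by_cases h : M.trace = 0
  · obtain ⟨ρ, hρ⟩ := exists_isState I
    exact ⟨ρ, hρ, by rw [hM.trace_eq_zero_iff.1 h]; simp⟩
  · refine ⟨M.trace⁻¹ • M, ⟨hM.smul ?_, ?_⟩, ?_⟩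
    · rw [← hre, ← Complex.ofReal_inv]
      exact_mod_cast inv_nonneg.2 h0.1
    · simp [trace_smul, h]
    · rw [hre, smul_smul, mul_inv_cancel₀ h, one_smul]

theorem isSeparableState_sum {ι A B : Type*} [Fintype ι] [Fintype A] [Nonempty A] [Fintype B]
    {M : ι → Matrix A A ℂ} {φ : ι → Matrix B B ℂ} (hM : ∀ i, (M i).PosSemidef)
    (h1 : (∑ i, M i).trace = 1) (hφ : ∀ i, IsState (φ i)) :
    IsSeparableState (∑ i, kroneckerMap (fun x y => x * y) (M i) (φ i)) := by
  choose ρ hρ hMρ using fun i => PosSemidef.exists_isState_smul (hM i)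
  have : ∑ i, kroneckerMap (fun x y => x * y) (M i) (φ i) =
      ∑ i, (M i).trace.re • kroneckerMap (fun x y => x * y) (ρ i) (φ i) := by
    refine Finset.sum_congr rfl fun i _ => ?_
    conv_lhs => rw [hMρ i]
    ext p q
    simp [kroneckerMap_apply, mul_assoc]
  rw [this]
  refine (convex_convexHull ℝ _).sum_mem
    (fun i _ => by simpa using (Complex.le_def.1 (hM i).trace_nonneg).1) ?_
    fun i _ => subset_convexHull ℝ _ ⟨ρ i, φ i, hρ i, hφ i, rfl⟩
  have := congrArg Complex.re h1
  simpa [trace_sum] using this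

/-! ### From Choi matrices back to channels -/

/-- The linear map with the given Choi matrix. -/
noncomputable def ofChoi {I O : Type*} [Fintype I] (φ : Matrix (I × O) (I × O) ℂ) :
    Matrix I I ℂ →ₗ[ℂ] Matrix O O ℂ where
  toFun ρ := of fun y y' => (Fintype.card I : ℂ) * ∑ x, ∑ x', ρ x x' * φ (x, y) (x', y')
  map_add' ρ σ := by
    ext y y'
    simp [add_mul, Finset.sum_add_distrib, mul_add]
  map_smul' c ρ := by
    ext y y'
    simp only [Matrix.smul_apply, of_apply, smul_eq_mul, RingHom.id_apply, mul_assoc]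
    simp only [← Finset.mul_sum]
    ring

theorem choi_ofChoi {I O : Type*} [Fintype I] [DecidableEq I] [Nonempty I]
    (φ : Matrix (I × O) (I × O) ℂ) : choi (ofChoi φ) = φ := by
  ext p q
  rw [choi_apply, ofChoi]
  simp [Matrix.single_apply, ite_and]

/-- Applying `id ⊗ ofChoi φ` to `ρ` contracts `ρ ⊗ φ` over the shared index, up to a positive
factor, which gives complete positivity; the marginal condition gives trace preservation. -/
theorem isChannel_ofChoi {I O : Type*} [Fintype I] [DecidableEq I] [Nonempty I] [Fintype O]
    {φ : Matrix (I × O) (I × O) ℂ} (hφ : φ.PosSemidef)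
    (h : trRight φ = (Fintype.card I : ℂ)⁻¹ • 1) : IsChannel (ofChoi φ) := by
  constructor
  · intro k ρ hρ
    have h1 := (hρ.kronecker hφ).submatrix
      (fun p : (Fin k × O) × I => ((p.1.1, p.2), (p.2, p.1.2)))
    have h2 := (posSemidef_sum_contract h1).smul (a := (Fintype.card I : ℂ)) (by positivity)
    exact h2
  · intro ρ
    have h2 : ∀ x x', ∑ y, φ (x, y) (x', y) = if x = x' then (Fintype.card I : ℂ)⁻¹ else 0 := by
      intro x x'
      have := congrFun (congrFun h x) x'
      simpa [trRight, Matrix.one_apply] using this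
    simp only [trace, diag_apply, ofChoi, LinearMap.coe_mk, AddHom.coe_mk, of_apply]
    rw [← Finset.mul_sum, Finset.sum_comm]
    simp_rw [Finset.sum_comm (s := (Finset.univ : Finset O)), ← Finset.mul_sum, h2]
    simp [← Finset.sum_mul, mul_comm]

/-! ### An informationally complete measurement and its dual frame -/

/-- Together with the next two lemmas, this is the polarization identity in coordinates: summing
over fourth roots of unity isolates the terms with a given phase. -/
theorem sum_phase (α β γ δ : ℂ) :
    ∑ k : Fin 4, (α + Complex.I ^ (k : ℕ) * β) * (γ + (-Complex.I) ^ (k : ℕ) * δ) =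
      4 * (α * γ + β * δ) := by
  simp [Fin.sum_univ_four, pow_succ]
  linear_combination -2 * β * δ * Complex.I_mul_I

theorem sum_neg_I_pow_mul_phase (α β γ δ : ℂ) :
    ∑ k : Fin 4, (-Complex.I) ^ (k : ℕ) *
      ((α + Complex.I ^ (k : ℕ) * β) * (γ + (-Complex.I) ^ (k : ℕ) * δ)) = 4 * (β * γ) := by
  simp [Fin.sum_univ_four, pow_succ]
  linear_combination (2 * α * δ - 2 * β * γ) * Complex.I_mul_I

theorem sum_I_pow_mul_phase (α β γ δ : ℂ) :
    ∑ k : Fin 4, Complex.I ^ (k : ℕ) *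
      ((α + Complex.I ^ (k : ℕ) * β) * (γ + (-Complex.I) ^ (k : ℕ) * δ)) = 4 * (α * δ) := by
  simp [Fin.sum_univ_four, pow_succ]
  linear_combination (2 * β * γ - 2 * α * δ) * Complex.I_mul_I

theorem star_indicator (P : Prop) [Decidable P] :
    star (if P then (1 : ℂ) else 0) = if P then 1 else 0 := by
  split_ifs <;> simp

/-- An informationally complete measurement `E` together with a Hermitian dual frame `D`. -/
theorem exists_tomography (B : Type*) [Fintype B] [DecidableEq B] [Nonempty B] :
    ∃ E D : B × B × Fin 4 → Matrix B B ℂ, (∀ z, (E z).PosSemidef) ∧ ∑ z, E z = 1 ∧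
      (∀ z, (D z).IsHermitian) ∧ (∀ z b b', ‖D z b b'‖ ≤ 2 * Fintype.card B) ∧
      ∀ b b', ∑ z, D z b b' • E z = single b' b 1 := by
  have hd : (Fintype.card B : ℂ) ≠ 0 := by simp
  -- The polarization vectors `e_a + i^k e_b`. Over all `a, b, k` their projectors sum to `8 d`
  -- times the identity, whence the normalization of `E`.
  let v : B × B × Fin 4 → B → ℂ := fun z c =>
    (if c = z.1 then 1 else 0) + Complex.I ^ (z.2.2 : ℕ) * (if c = z.2.1 then 1 else 0)
  let E : B × B × Fin 4 → Matrix B B ℂ := fun z =>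
    (8 * Fintype.card B : ℂ)⁻¹ • vecMulVec (v z) (star (v z))
  -- The two matrix units make `D z` Hermitian; by polarization each supplies half of the dual
  -- identity.
  let D : B × B × Fin 4 → Matrix B B ℂ := fun z => of fun p q =>
    Fintype.card B * ((-Complex.I) ^ (z.2.2 : ℕ) * (if p = z.1 ∧ q = z.2.1 then 1 else 0) +
      Complex.I ^ (z.2.2 : ℕ) * (if p = z.2.1 ∧ q = z.1 then 1 else 0))
  have hE : ∀ a b k c c', E (a, b, k) c c' = (8 * Fintype.card B : ℂ)⁻¹ *
      (((if c = a then 1 else 0) + Complex.I ^ (k : ℕ) * (if c = b then 1 else 0)) *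
      ((if c' = a then 1 else 0) + (-Complex.I) ^ (k : ℕ) * (if c' = b then 1 else 0))) := by
    intro a b k c c'
    simp only [E, v, Matrix.smul_apply, vecMulVec_apply, Pi.star_apply, smul_eq_mul]
    rw [star_add, star_mul', star_pow, star_indicator, star_indicator, Complex.star_def,
      Complex.conj_I]
  have hD : ∀ a b k p q, D (a, b, k) p q = Fintype.card B *
      ((-Complex.I) ^ (k : ℕ) * (if p = a ∧ q = b then 1 else 0) +
        Complex.I ^ (k : ℕ) * (if p = b ∧ q = a then 1 else 0)) := fun _ _ _ _ _ => rfl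
  refine ⟨E, D, fun z => ?_, ?_, ?_, ?_, ?_⟩
  · exact (posSemidef_vecMulVec_self_star _).smul (by positivity)
  · ext c c'
    rw [Matrix.sum_apply, Fintype.sum_prod_type]
    simp_rw [Fintype.sum_prod_type, hE, ← Finset.mul_sum, sum_phase]
    simp only [← Finset.mul_sum, Finset.sum_add_distrib]
    simp [Matrix.one_apply]
    split_ifs
    · field_simp
      norm_num
    · simp
  · rintro ⟨a, b, k⟩
    ext p q
    rw [conjTranspose_apply, hD, hD]
    have h1 : (q = a ∧ p = b) = (p = b ∧ q = a) := propext and_comm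
    have h2 : (q = b ∧ p = a) = (p = a ∧ q = b) := propext and_comm
    simp only [h1, h2]
    rw [star_mul', star_add, star_mul', star_mul', star_pow, star_pow, star_indicator,
      star_indicator, star_neg, Complex.star_def, Complex.conj_I, Complex.conj_natCast, neg_neg, add_comm]
  · rintro ⟨a, b, k⟩ p q
    rw [hD, show (2 : ℝ) * Fintype.card B = Fintype.card B * (1 + 1) by ring, norm_mul,
      Complex.norm_natCast]
    gcongr
    refine (norm_add_le _ _).trans (add_le_add ?_ ?_) <;> split_ifs <;> simp
  · intro p q
    ext c c'
    rw [Matrix.sum_apply, Fintype.sum_prod_type]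
    simp_rw [Fintype.sum_prod_type, Matrix.smul_apply, smul_eq_mul, hE, hD]
    have : ∀ (a b : B) (w : Fin 4 → ℂ), ∑ k : Fin 4, (Fintype.card B : ℂ) *
        ((-Complex.I) ^ (k : ℕ) * (if p = a ∧ q = b then 1 else 0) +
          Complex.I ^ (k : ℕ) * (if p = b ∧ q = a then 1 else 0)) *
        ((8 * Fintype.card B : ℂ)⁻¹ * w k) =
        8⁻¹ * ((if p = a ∧ q = b then 1 else 0) * ∑ k : Fin 4, (-Complex.I) ^ (k : ℕ) * w k +
          (if p = b ∧ q = a then 1 else 0) * ∑ k : Fin 4, Complex.I ^ (k : ℕ) * w k) := by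
      intro a b w
      rw [Finset.mul_sum, Finset.mul_sum, ← Finset.sum_add_distrib, Finset.mul_sum]
      refine Finset.sum_congr rfl fun k _ => ?_
      field_simp
    simp_rw [this, sum_neg_I_pow_mul_phase, sum_I_pow_mul_phase, ← Finset.mul_sum,
      Finset.sum_add_distrib]
    simp only [ite_and, ite_mul, one_mul, zero_mul, Finset.sum_ite_eq, Finset.mem_univ, if_true,
      Finset.sum_ite_irrel, Finset.sum_const_zero]
    rw [Matrix.single_apply]
    simp only [eq_comm (a := q), eq_comm (a := p)]
    by_cases h1 : c = q <;> by_cases h2 : c' = p <;> simp [h1, h2]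
    norm_num

/-! ### Contracting all registers against local operators -/

theorem posSemidef_hadamard {I : Type*} {M N : Matrix I I ℂ} (hM : M.PosSemidef)
    (hN : N.PosSemidef) : (of fun i j => M i j * N i j).PosSemidef := by
  have h := PosSemidef.hadamard (𝕜 := ℂ) hM hN
  exact h

section Contraction

variable {A B J Z : Type*} [Fintype B] [Fintype J] [DecidableEq J]

/-- The operator `tr_{B^J} [ω (1 ⊗ ⨂ⱼ G j)]`. -/
noncomputable def contract (ω : Matrix (A × (J → B)) (A × (J → B)) ℂ) (G : J → Matrix B B ℂ) :
    Matrix A A ℂ :=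
  of fun a a' => ∑ b : J → B, ∑ b' : J → B, ω (a, b) (a', b') * ∏ j, G j (b' j) (b j)

/-- Before summation, the summand is the Hadamard product of `ω` with transposes of the `G j`, which
is positive by Schur's theorem. -/
theorem posSemidef_contract [Fintype A] {ω : Matrix (A × (J → B)) (A × (J → B)) ℂ}
    (hω : ω.PosSemidef) {G : J → Matrix B B ℂ} (hG : ∀ j, (G j).PosSemidef) :
    (contract ω G).PosSemidef := by
  have hprod : ∀ s : Finset J, (of fun p q : A × (J → B) =>
      ∏ j ∈ s, G j (q.2 j) (p.2 j)).PosSemidef := by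
    intro s
    induction s using Finset.induction_on with
    | empty =>
      simp only [Finset.prod_empty]
      convert posSemidef_vecMulVec_self_star (fun _ : A × (J → B) => (1 : ℂ)) using 1
      ext p q
      simp [vecMulVec_apply]
    | insert i s hi ih =>
      simp only [Finset.prod_insert hi]
      exact posSemidef_hadamard ((hG i).transpose.submatrix (fun p : A × (J → B) => p.2 i)) ih
  have h := posSemidef_sum_contract (posSemidef_hadamard hω (hprod Finset.univ))
  exact h

theorem contract_comp_perm {ω : Matrix (A × (J → B)) (A × (J → B)) ℂ}
    (hω : ∀ (s : Equiv.Perm J) a b a' b', ω (a, b ∘ s) (a', b' ∘ s) = ω (a, b) (a', b'))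
    (G : J → Matrix B B ℂ) (s : Equiv.Perm J) : contract ω (G ∘ s) = contract ω G := by
  ext a a'
  simp only [contract, of_apply]
  let e : (J → B) ≃ (J → B) := s.arrowCongr (Equiv.refl B)
  have he : ∀ b, b = e b ∘ s := fun b => by ext j; simp [e]
  refine Fintype.sum_equiv e _ _ fun b => Fintype.sum_equiv e _ _ fun b' => ?_
  conv_lhs => rw [he b, he b', hω]
  congr 1
  exact Fintype.prod_equiv s _ _ fun j => rfl

theorem sum_contract [Fintype Z] (ω : Matrix (A × (J → B)) (A × (J → B)) ℂ)
    (E : Z → Matrix B B ℂ) (g : J → Z → ℂ) :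
    ∑ z : J → Z, (∏ j, g j (z j)) • contract ω (fun j => E (z j)) =
      contract ω (fun j => ∑ z, g j z • E z) := by
  ext a a'
  simp only [contract, Matrix.sum_apply, Matrix.smul_apply, of_apply, smul_eq_mul]
  simp_rw [Finset.prod_univ_sum, Fintype.piFinset_univ, Finset.mul_sum]
  rw [Finset.sum_comm]
  refine Finset.sum_congr rfl fun b _ => ?_
  rw [Finset.sum_comm]
  refine Finset.sum_congr rfl fun b' _ => Finset.sum_congr rfl fun z _ => ?_
  rw [Finset.prod_mul_distrib]
  ring

theorem sum_contract_sumElim {S T : Type*} [Fintype S] [Fintype T] [DecidableEq S] [DecidableEq T]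
    [Fintype Z]
    (ω : Matrix (A × (S ⊕ T → B)) (A × (S ⊕ T → B)) ℂ) (E : Z → Matrix B B ℂ) (u : S → Z)
    (g : T → Z → ℂ) :
    ∑ w : T → Z, (∏ t, g t (w t)) • contract ω (fun j => E (Sum.elim u w j)) =
      contract ω (Sum.elim (fun s => E (u s)) (fun t => ∑ z, g t z • E z)) := by
  ext a a'
  simp only [contract, Matrix.sum_apply, Matrix.smul_apply, of_apply, smul_eq_mul,
    Fintype.prod_sum_type, Sum.elim_inl, Sum.elim_inr]
  simp_rw [Finset.prod_univ_sum, Fintype.piFinset_univ, Finset.mul_sum]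
  rw [Finset.sum_comm]
  refine Finset.sum_congr rfl fun b _ => ?_
  rw [Finset.sum_comm]
  refine Finset.sum_congr rfl fun b' _ => Finset.sum_congr rfl fun z _ => ?_
  rw [Finset.prod_mul_distrib]
  ring

/-- Identities on `Y` trace out the outputs, so only the marginal on `A` and the inputs is seen; as
this is a multiple of the identity, the value factorizes over registers. -/
theorem contract_kronecker_one {X Y : Type*} [Fintype X] [Fintype Y] [DecidableEq Y]
    [DecidableEq A] [DecidableEq X]
    {ω : Matrix (A × (J → X × Y)) (A × (J → X × Y)) ℂ} {c : ℂ}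
    (hω : ∀ a a' (x x' : J → X), ∑ y : J → Y,
      ω (a, fun j => (x j, y j)) (a', fun j => (x' j, y j)) =
        if a = a' ∧ x = x' then c else 0) (R : J → Matrix X X ℂ) :
    contract ω (fun j => kroneckerMap (fun x y => x * y) (R j) (1 : Matrix Y Y ℂ)) =
      (c * ∏ j, (R j).trace) • 1 := by
  ext a a'
  let e := (Equiv.arrowProdEquivProdArrow J (fun _ => X) (fun _ => Y)).symm
  have h1 : ∀ y y' : J → Y, (∏ j, (1 : Matrix Y Y ℂ) (y' j) (y j)) = if y = y' then 1 else 0 := by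
    intro y y'
    simp [Matrix.one_apply, Finset.prod_ite_zero, funext_iff, eq_comm]
  simp only [contract, of_apply]
  rw [← e.sum_comp]
  simp_rw [← e.sum_comp (fun b' : J → X × Y => ω _ (a', b') * _)]
  simp only [Fintype.sum_prod_type, kroneckerMap_apply, Finset.prod_mul_distrib]
  have h2 : ∀ (x : J → X) (y : J → Y), e (x, y) = fun j => (x j, y j) := fun x y => rfl
  simp only [h2, h1]
  simp only [mul_ite, mul_one, mul_zero, Finset.sum_ite_eq, Finset.mem_univ, if_true]
  simp_rw [Finset.sum_comm (s := (Finset.univ : Finset (J → Y))), ← Finset.sum_mul, hω]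
  simp only [Matrix.smul_apply, Matrix.one_apply, smul_eq_mul, trace, diag_apply,
    Finset.prod_univ_sum, Fintype.piFinset_univ, ite_and, ite_mul, zero_mul]
  by_cases h : a = a' <;> simp [h, Finset.mul_sum]

end Contraction

/-! ### Weighted second-moment inequalities -/

section Probability

/-- Jensen's inequality for the square: `t u` is the conditional mean of `f u`. -/
theorem sum_mul_norm_sub_sq_le {U W : Type*} [Fintype U] [Fintype W] {p : U → W → ℝ}
    (hp : ∀ u w, 0 ≤ p u w) {f : U → W → ℂ} {h t : U → ℂ}
    (ht : ∀ u, ((∑ w, p u w : ℝ) : ℂ) * t u = ∑ w, p u w * f u w) :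
    ∑ u, (∑ w, p u w) * ‖t u - h u‖ ^ 2 ≤ ∑ u, ∑ w, p u w * ‖f u w - h u‖ ^ 2 := by
  refine Finset.sum_le_sum fun u _ => ?_
  have hq : 0 ≤ ∑ w, p u w := Finset.sum_nonneg fun w _ => hp u w
  rcases hq.eq_or_lt with h0 | h0
  · rw [← h0, zero_mul]
    exact Finset.sum_nonneg fun w _ => mul_nonneg (hp u w) (by positivity)
  have h1 : (∑ w, p u w) * ‖t u - h u‖ ≤ ∑ w, p u w * ‖f u w - h u‖ := by
    have : ((∑ w, p u w : ℝ) : ℂ) * (t u - h u) = ∑ w, (p u w : ℂ) * (f u w - h u) := by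
      rw [mul_sub, ht u]
      simp [mul_sub, Finset.sum_sub_distrib, Finset.sum_mul]
    calc _ = ‖((∑ w, p u w : ℝ) : ℂ) * (t u - h u)‖ := by
          rw [norm_mul, Complex.norm_real, Real.norm_of_nonneg hq]
      _ ≤ _ := by
          rw [this]
          refine (norm_sum_le _ _).trans (Finset.sum_le_sum fun w _ => ?_)
          rw [norm_mul, Complex.norm_real, Real.norm_of_nonneg (hp u w)]
  have h2 : (∑ w, p u w * ‖f u w - h u‖) ^ 2 ≤
      (∑ w, p u w) * ∑ w, p u w * ‖f u w - h u‖ ^ 2 := by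
    refine Finset.sum_sq_le_sum_mul_sum_of_sq_le_mul _ (fun w _ => hp u w)
      (fun w _ => mul_nonneg (hp u w) (by positivity)) fun w _ => le_of_eq (by ring)
  have h3 : ((∑ w, p u w) * ‖t u - h u‖) ^ 2 ≤
      (∑ w, p u w) * ∑ w, p u w * ‖f u w - h u‖ ^ 2 := le_trans (by gcongr) h2
  refine le_of_mul_le_mul_left ?_ h0
  linarith [h3]

/-- When the square is expanded, the common correlation `f` contributes `f * (∑ c)²`, and only
corrected diagonal terms survive. The hypothesis `hc` covers both uses: exchangeable variables with
coefficients summing to zero, and uncorrelated variables with arbitrary coefficients. -/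
theorem sum_mul_norm_sum_sq_le {K J : Type*} [Fintype K] [Fintype J] [DecidableEq J]
    {p : K → ℝ} {ξ : J → K → ℂ} {f : ℂ} {V : ℝ}
    (hpair : ∀ i j, i ≠ j → ∑ z, p z * (ξ i z * star (ξ j z)) = f) (hf : ‖f‖ ≤ V)
    (hV : ∀ i, ∑ z, p z * ‖ξ i z‖ ^ 2 ≤ V) (c : J → ℝ) (hc : f * (∑ j, c j : ℝ) ^ 2 = 0) :
    ∑ z, p z * ‖∑ j, c j * ξ j z‖ ^ 2 ≤ 2 * V * ∑ j, c j ^ 2 := by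
  have hentry : ∀ i j, ∑ z, p z * (ξ i z * star (ξ j z)) =
      f + if i = j then ((∑ z, p z * ‖ξ i z‖ ^ 2 : ℝ) : ℂ) - f else 0 := by
    intro i j
    split_ifs with h
    · subst h
      simp [Complex.mul_conj']
    · rw [hpair i j h, add_zero]
  have h1 : ((∑ z, p z * ‖∑ j, c j * ξ j z‖ ^ 2 : ℝ) : ℂ) =
      ∑ i, (c i : ℂ) ^ 2 * (((∑ z, p z * ‖ξ i z‖ ^ 2 : ℝ) : ℂ) - f) := by
    calc ((∑ z, p z * ‖∑ j, c j * ξ j z‖ ^ 2 : ℝ) : ℂ)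
        = ∑ z, (p z : ℂ) * ((∑ i, c i * ξ i z) * star (∑ j, c j * ξ j z)) := by
          simp only [Complex.star_def, Complex.mul_conj']
          push_cast
          rfl
      _ = ∑ i, ∑ j, (c i : ℂ) * c j * ∑ z, p z * (ξ i z * star (ξ j z)) := by
          simp only [star_sum, Finset.sum_mul_sum]
          simp only [Finset.mul_sum]
          rw [Finset.sum_comm]
          refine Finset.sum_congr rfl fun i _ => ?_
          rw [Finset.sum_comm]
          refine Finset.sum_congr rfl fun j _ => Finset.sum_congr rfl fun z _ => ?_
          simp
          ring
      _ = f * (∑ j, c j : ℝ) ^ 2 +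
          ∑ i, (c i : ℂ) ^ 2 * (((∑ z, p z * ‖ξ i z‖ ^ 2 : ℝ) : ℂ) - f) := by
          simp only [hentry, mul_add, Finset.sum_add_distrib, mul_ite, mul_zero,
            Finset.sum_ite_eq, Finset.mem_univ, if_true]
          congr 1
          · push_cast
            rw [pow_two, Finset.sum_mul_sum, Finset.mul_sum]
            refine Finset.sum_congr rfl fun i _ => ?_
            rw [Finset.mul_sum]
            exact Finset.sum_congr rfl fun j _ => by ring
          · exact Finset.sum_congr rfl fun i _ => by ring
      _ = _ := by rw [hc, zero_add]
  have h2 := congrArg Complex.re h1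
  rw [Complex.ofReal_re, Complex.re_sum] at h2
  rw [h2, Finset.mul_sum]
  refine Finset.sum_le_sum fun i _ => ?_
  have h3 : (f.re) ≥ -V := by
    have := (abs_le.1 ((Complex.abs_re_le_norm f).trans hf)).1
    linarith
  rw [← Complex.ofReal_pow, Complex.re_ofReal_mul, Complex.sub_re, Complex.ofReal_re]
  nlinarith [sq_nonneg (c i), hV i]

theorem sum_mul_le_sqrt {U : Type*} [Fintype U] {q δ : U → ℝ} (hq : ∀ u, 0 ≤ q u)
    (h1 : ∑ u, q u = 1) {c : ℝ} (hc : ∑ u, q u * δ u ^ 2 ≤ c) :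
    ∑ u, q u * δ u ≤ Real.sqrt c := by
  refine Real.le_sqrt_of_sq_le (le_trans ?_ hc)
  have := Finset.sum_sq_le_sum_mul_sum_of_sq_le_mul Finset.univ (r := fun u => q u * δ u)
    (f := q) (g := fun u => q u * δ u ^ 2) (fun u _ => hq u)
    (fun u _ => mul_nonneg (hq u) (sq_nonneg _)) fun u _ => le_of_eq (by ring)
  simpa [h1] using this

end Probability

/-! ### Repairing the input marginal of a state -/

theorem trRight_kronecker {X Y : Type*} [Fintype Y] (R : Matrix X X ℂ) (S : Matrix Y Y ℂ) :
    trRight (kroneckerMap (fun x y => x * y) R S) = S.trace • R := by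
  ext x x'
  simp [trRight, trace, ← Finset.mul_sum, mul_comm]

theorem trRight_add {X Y : Type*} [Fintype Y] (R S : Matrix (X × Y) (X × Y) ℂ) :
    trRight (R + S) = trRight R + trRight S := by
  ext x x'
  simp [trRight, Finset.sum_add_distrib]

theorem trRight_smul {X Y : Type*} [Fintype Y] (c : ℂ) (R : Matrix (X × Y) (X × Y) ℂ) :
    trRight (c • R) = c • trRight R := by
  ext x x'
  simp [trRight, Finset.mul_sum]

theorem trace_trRight {X Y : Type*} [Fintype X] [Fintype Y] (R : Matrix (X × Y) (X × Y) ℂ) :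
    (trRight R).trace = R.trace := by
  simp [trRight, trace, Fintype.sum_prod_type]

/-- Adding the positive operator `(δ + H) ⊗ 1/d_Y` raises the marginal to a multiple of the
identity, and rescaling restores trace one. Positivity holds because `δ` dominates the
Hilbert–Schmidt norm of the defect `H`. -/
theorem exists_state_trRight_eq {X Y : Type*} [Fintype X] [Fintype Y] [DecidableEq X]
    [DecidableEq Y] [Nonempty X] [Nonempty Y] {τ : Matrix (X × Y) (X × Y) ℂ} (hτ : IsState τ)
    {δ : ℝ} (h0 : 0 ≤ δ)
    (hδ : ∑ i, ∑ j, ‖((Fintype.card X : ℂ)⁻¹ • (1 : Matrix X X ℂ) - trRight τ) i j‖ ^ 2 ≤ δ ^ 2) :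
    ∃ τ' : Matrix (X × Y) (X × Y) ℂ, IsState τ' ∧
      trRight τ' = (Fintype.card X : ℂ)⁻¹ • (1 : Matrix X X ℂ) ∧
      TraceBounded (τ - τ') (2 * Fintype.card X * δ) := by
  set d : ℝ := (Fintype.card X : ℝ) with hd
  have hdc : (Fintype.card X : ℂ) = (d : ℂ) := by simp [hd]
  have hd0 : 0 < d := by simp [hd, Fintype.card_pos]
  have hdd : 0 ≤ d * δ := by positivity
  set H := (Fintype.card X : ℂ)⁻¹ • (1 : Matrix X X ℂ) - trRight τ with hH
  have hHerm : H.IsHermitian :=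
    (PosSemidef.one.smul (a := (Fintype.card X : ℂ)⁻¹) (by positivity)).1.sub
      (posSemidef_trRight hτ.1).1
  have hP := posSemidef_smul_one_add hHerm h0 hδ
  set N := kroneckerMap (fun x y => x * y) ((δ : ℂ) • (1 : Matrix X X ℂ) + H)
    ((Fintype.card Y : ℂ)⁻¹ • (1 : Matrix Y Y ℂ)) with hN
  have hNpos : N.PosSemidef := hP.kronecker (PosSemidef.one.smul (by positivity))
  have hNr : trRight N = (δ : ℂ) • (1 : Matrix X X ℂ) + H := by
    rw [hN, trRight_kronecker]
    simp [trace_smul]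
  have hNt : N.trace = ((d * δ : ℝ) : ℂ) := by
    rw [← trace_trRight, hNr, hH, trace_add, trace_sub, trace_smul, trace_smul, trace_trRight,
      hτ.2]
    simp [hd, mul_comm]
  have hne : (1 + d * δ) ≠ 0 := by positivity
  have hnec : (1 + d * δ : ℂ) ≠ 0 := by exact_mod_cast hne
  set c : ℝ := (1 + d * δ)⁻¹ with hc
  have hc0 : 0 ≤ c := by positivity
  have hc1 : c ≤ 1 := inv_le_one_of_one_le₀ (by linarith)
  have hc0' : (0 : ℂ) ≤ c := by exact_mod_cast hc0
  have hc1' : (0 : ℂ) ≤ 1 - c := by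
    rw [← Complex.ofReal_one, ← Complex.ofReal_sub]
    exact_mod_cast sub_nonneg.2 hc1
  have hcc : c * (1 + d * δ) = 1 := inv_mul_cancel₀ hne
  have hccc : (c : ℂ) * (1 + d * δ) = 1 := by exact_mod_cast hcc
  refine ⟨(c : ℂ) • (τ + N), ⟨(hτ.1.add hNpos).smul hc0', ?_⟩, ?_, ?_⟩
  · rw [trace_smul, trace_add, hτ.2, hNt, smul_eq_mul]
    push_cast
    exact hccc
  · rw [trRight_smul, trRight_add, hNr, hH]
    have : trRight τ + ((δ : ℂ) • (1 : Matrix X X ℂ) +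
        ((Fintype.card X : ℂ)⁻¹ • (1 : Matrix X X ℂ) - trRight τ)) =
        (δ + (Fintype.card X : ℂ)⁻¹) • (1 : Matrix X X ℂ) := by
      rw [add_smul]; abel
    rw [this, smul_smul, hdc]
    congr 1
    have hd' : (d : ℂ) ≠ 0 := by exact_mod_cast hd0.ne'
    field_simp
    linear_combination hccc
  -- Both parts have the same trace, since `1 - c = c * d * δ`.
  · refine ⟨(1 - c : ℂ) • τ, (c : ℂ) • N, hτ.1.smul hc1', hNpos.smul hc0', ?_, ?_⟩
    · rw [sub_smul, one_smul, smul_add]; abel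
    · rw [trace_smul, trace_smul, hτ.2, hNt]
      simp only [smul_eq_mul, mul_one, Complex.add_re, Complex.sub_re, Complex.one_re,
        Complex.ofReal_re, ← Complex.ofReal_mul]
      nlinarith [mul_le_mul_of_nonneg_right hc1 hdd]

/-! ### Local outcome statistics and their symmetries -/

theorem prod_update_one {J Z : Type*} [Fintype J] [DecidableEq J] (j : J) (h : Z → ℂ)
    (z : J → Z) : ∏ i, Function.update (fun _ _ => (1 : ℂ)) j h i (z i) = h (z j) := by
  rw [Finset.prod_eq_single j]
  · simp
  · intro i _ hi
    simp [Function.update_of_ne hi]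
  · simp

theorem sum_update_one_smul {J Z B : Type*} [Fintype Z] [DecidableEq J] [DecidableEq B]
    {E : Z → Matrix B B ℂ} (hE1 : ∑ z, E z = 1) (j : J) (h : Z → ℂ) :
    (fun i => ∑ z, Function.update (fun _ _ => (1 : ℂ)) j h i z • E z) =
      Function.update (fun _ => 1) j (∑ z, h z • E z) := by
  funext i
  by_cases hi : i = j
  · subst hi
    simp
  · simp [Function.update_of_ne hi, hE1]

section Exchangeable

variable {J : Type*} [DecidableEq J]

theorem sum_comp_perm {Z V : Type*} [Fintype J] [Fintype Z] [AddCommMonoid V] (s : Equiv.Perm J) (F : (J → Z) → V) : ∑ z, F (z ∘ s) = ∑ z, F z :=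
  Fintype.sum_equiv (s.symm.arrowCongr (Equiv.refl Z)) _ _ fun z => by
    congr 1

theorem exists_perm_pair {i j i' j' : J} (h : i ≠ j) (h' : i' ≠ j') :
    ∃ s : Equiv.Perm J, s i = i' ∧ s j = j' := by
  have h1 : Equiv.swap i i' j ≠ i' := fun e => h (by
    have := (Equiv.swap i i').injective (e.trans (Equiv.swap_apply_left i i').symm)
    exact this.symm)
  refine ⟨(Equiv.swap i i').trans (Equiv.swap (Equiv.swap i i' j) j'), ?_, ?_⟩
  · rw [Equiv.trans_apply, Equiv.swap_apply_left, Equiv.swap_apply_of_ne_of_ne h1.symm h']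
  · rw [Equiv.trans_apply, Equiv.swap_apply_left]

end Exchangeable

theorem _root_.Matrix.PosSemidef.ofReal_trace_re {I : Type*} [Fintype I] {M : Matrix I I ℂ}
    (hM : M.PosSemidef) : ((M.trace.re : ℝ) : ℂ) = M.trace :=
  Complex.ext rfl (by simpa using (Complex.le_def.1 hM.trace_nonneg).2)

theorem trace_mul_vecMulVec_star {B : Type*} [Fintype B] (M : Matrix B B ℂ) (ψ : B → ℂ) :
    (M * vecMulVec ψ (star ψ)).trace = star ψ ⬝ᵥ (M *ᵥ ψ) := by
  rw [mul_vecMulVec, trace_vecMulVec, dotProduct_comm]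

section Outcomes

variable {A B J Z : Type*} [Fintype A] [Fintype B] [Fintype J] [DecidableEq J]
  {E : Z → Matrix B B ℂ}

/-- The probability of the outcomes `z` when each register of `ω` is measured with `E`. -/
noncomputable def outcomeProb
    (ω : Matrix (A × (J → B)) (A × (J → B)) ℂ) (E : Z → Matrix B B ℂ) (z : J → Z) : ℝ :=
  (contract ω (fun j => E (z j))).trace.re

theorem ofReal_outcomeProb
    {ω : Matrix (A × (J → B)) (A × (J → B)) ℂ} (hω : ω.PosSemidef)
    (hE : ∀ z, (E z).PosSemidef) (z : J → Z) :
    (outcomeProb ω E z : ℂ) = (contract ω (fun j => E (z j))).trace :=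
  (posSemidef_contract hω fun _ => hE _).ofReal_trace_re

theorem outcomeProb_nonneg
    {ω : Matrix (A × (J → B)) (A × (J → B)) ℂ} (hω : ω.PosSemidef)
    (hE : ∀ z, (E z).PosSemidef) (z : J → Z) : 0 ≤ outcomeProb ω E z :=
  (Complex.le_def.1 (posSemidef_contract hω fun j => hE (z j)).trace_nonneg).1

theorem outcomeProb_comp_perm
    {ω : Matrix (A × (J → B)) (A × (J → B)) ℂ}
    (hω : ∀ (s : Equiv.Perm J) a b a' b', ω (a, b ∘ s) (a', b' ∘ s) = ω (a, b) (a', b'))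
    (z : J → Z) (s : Equiv.Perm J) : outcomeProb ω E (z ∘ s) = outcomeProb ω E z := by
  rw [outcomeProb, outcomeProb, ← contract_comp_perm hω (fun j => E (z j)) s]
  rfl

end Outcomes

/-! ### Reconstruction from outcomes through the dual frame -/

section Tomography

variable {A B Z : Type*} [Fintype B] [DecidableEq B] [Fintype Z]
  {E D : Z → Matrix B B ℂ}

theorem sum_trace_dual_smul (hdual : ∀ b b', ∑ z, D z b b' • E z = single b' b 1)
    (R : Matrix B B ℂ) : ∑ z, (D z * R).trace • E z = R := by
  simp only [trace, diag_apply, Matrix.mul_apply, Finset.sum_smul]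
  rw [Finset.sum_comm]
  have : ∀ b, ∑ z, ∑ b', (D z b b' * R b' b) • E z = ∑ b', R b' b • single b' b (1 : ℂ) := by
    intro b
    rw [Finset.sum_comm]
    refine Finset.sum_congr rfl fun b' _ => ?_
    rw [← hdual b b', Finset.smul_sum]
    exact Finset.sum_congr rfl fun z _ => by rw [smul_smul, mul_comm]
  simp_rw [this]
  rw [Finset.sum_comm]
  conv_rhs => rw [matrix_eq_sum_single R]
  simp [smul_single]

variable {S T : Type*} [Fintype S] [Fintype T] [DecidableEq S] [DecidableEq T]

theorem sum_trace_smul_contract (hE1 : ∑ z, E z = 1)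
    (hdual : ∀ b b', ∑ z, D z b b' • E z = single b' b 1)
    (ω : Matrix (A × (S ⊕ T → B)) (A × (S ⊕ T → B)) ℂ) (u : S → Z) (t : T) (R : Matrix B B ℂ) :
    ∑ w : T → Z, (D (w t) * R).trace • contract ω (fun j => E (Sum.elim u w j)) =
      contract ω (Sum.elim (fun s => E (u s)) (Function.update (fun _ => 1) t R)) := by
  have h := sum_contract_sumElim ω E u
    (Function.update (fun _ _ => (1 : ℂ)) t fun z => (D z * R).trace)
  rw [sum_update_one_smul hE1, sum_trace_dual_smul hdual] at h
  simpa only [prod_update_one] using h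

theorem sum_contract_right (hE1 : ∑ z, E z = 1)
    (ω : Matrix (A × (S ⊕ T → B)) (A × (S ⊕ T → B)) ℂ) (u : S → Z) :
    ∑ w : T → Z, contract ω (fun j => E (Sum.elim u w j)) =
      contract ω (Sum.elim (fun s => E (u s)) (fun _ => 1)) := by
  have h := sum_contract_sumElim ω E u (fun _ _ => (1 : ℂ))
  simpa [hE1] using h

theorem sum_dual_smul_contract {J : Type*} [Fintype J] [DecidableEq J] (hE1 : ∑ z, E z = 1)
    (hdual : ∀ b b', ∑ z, D z b b' • E z = single b' b 1)
    (ω : Matrix (A × (J → B)) (A × (J → B)) ℂ) (j : J) (b b' : B) :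
    ∑ z : J → Z, D (z j) b b' • contract ω (fun i => E (z i)) =
      contract ω (Function.update (fun _ => 1) j (single b' b 1)) := by
  have h := sum_contract ω E (Function.update (fun _ _ => (1 : ℂ)) j fun z => D z b b')
  rw [sum_update_one_smul hE1, hdual] at h
  simpa only [prod_update_one] using h

theorem contract_update_eq {J : Type*} [Fintype J] [DecidableEq J]
    {ω : Matrix (A × (J → B)) (A × (J → B)) ℂ}
    (hω : ∀ (s : Equiv.Perm J) a b a' b', ω (a, b ∘ s) (a', b' ∘ s) = ω (a, b) (a', b'))
    (i j : J) (R : Matrix B B ℂ) :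
    contract ω (Function.update (fun _ => 1) i R) =
      contract ω (Function.update (fun _ => 1) j R) := by
  rw [← contract_comp_perm hω _ (Equiv.swap i j)]
  congr 1
  funext k
  simp only [Function.comp_apply, Function.update_apply]
  congr 1
  rw [Equiv.swap_apply_eq_iff, Equiv.swap_apply_left]

variable [Fintype A]

/-- Averaging the dual frame over the outcomes on `T` gives an unnormalized state. -/
theorem exists_isState_conditional [Nonempty B] {ω : Matrix (A × (S ⊕ T → B)) (A × (S ⊕ T → B)) ℂ}
    (hω : ω.PosSemidef) (hE : ∀ z, (E z).PosSemidef) (hE1 : ∑ z, E z = 1)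
    (hD : ∀ z, (D z).IsHermitian) (hdual : ∀ b b', ∑ z, D z b b' • E z = single b' b 1)
    [Nonempty T] (u : S → Z) :
    ∃ τ : Matrix B B ℂ, IsState τ ∧ ((∑ w : T → Z, outcomeProb ω E (Sum.elim u w) : ℝ) : ℂ) • τ =
      ∑ w : T → Z, (outcomeProb ω E (Sum.elim u w) : ℂ) •
        ((Fintype.card T : ℂ)⁻¹ • ∑ t, D (w t)) := by
  have hp := ofReal_outcomeProb hω hE (Z := Z)
  have hpos : ∀ t, (∑ w : T → Z, (outcomeProb ω E (Sum.elim u w) : ℂ) • D (w t)).PosSemidef := by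
    intro t
    refine PosSemidef.of_dotProduct_mulVec_nonneg ?_ fun ψ => ?_
    · rw [IsHermitian, conjTranspose_sum]
      refine Finset.sum_congr rfl fun w _ => ?_
      rw [conjTranspose_smul, (hD _).eq]
      simp
    -- Averaging the dual frame against `ψ` reassembles the rank-one operator of `ψ` at register
    -- `t`, leaving a contraction of `ω` with positive operators only.
    · have h := congrArg trace (sum_trace_smul_contract hE1 hdual ω u t (vecMulVec ψ (star ψ)))
      have h2 : (contract ω (Sum.elim (fun s => E (u s))
          (Function.update (fun _ => 1) t (vecMulVec ψ (star ψ))))).PosSemidef := by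
        refine posSemidef_contract hω fun j => ?_
        rcases j with s | t'
        · exact hE _
        · by_cases ht : t' = t
          · subst ht
            simpa using posSemidef_vecMulVec_self_star ψ
          · simpa [Function.update_of_ne ht] using PosSemidef.one
      have h3 := h2.trace_nonneg
      rw [← h, trace_sum] at h3
      rw [sum_mulVec, dotProduct_sum]
      convert h3 using 2
      rw [trace_smul, trace_mul_vecMulVec_star, ← hp, smul_mulVec, dotProduct_smul, smul_eq_mul,
        smul_eq_mul, mul_comm]
  have htr : ∀ t, (∑ w : T → Z, (outcomeProb ω E (Sum.elim u w) : ℂ) • D (w t)).trace =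
      ((∑ w : T → Z, outcomeProb ω E (Sum.elim u w) : ℝ) : ℂ) := by
    intro t
    have h := congrArg trace (sum_trace_smul_contract hE1 hdual ω u t 1)
    rw [Function.update_eq_self_iff.2 rfl, ← sum_contract_right hE1, trace_sum, trace_sum] at h
    simp only [trace_smul, ← hp, Matrix.mul_one, smul_eq_mul] at h
    rw [trace_sum, Complex.ofReal_sum, ← h]
    exact Finset.sum_congr rfl fun w _ => by rw [trace_smul, smul_eq_mul, mul_comm]
  have heq : ∑ w : T → Z, (outcomeProb ω E (Sum.elim u w) : ℂ) •
        ((Fintype.card T : ℂ)⁻¹ • ∑ t, D (w t)) =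
      (Fintype.card T : ℂ)⁻¹ •
        ∑ t, ∑ w : T → Z, (outcomeProb ω E (Sum.elim u w) : ℂ) • D (w t) := by
    rw [Finset.sum_comm, Finset.smul_sum]
    refine Finset.sum_congr rfl fun w _ => ?_
    rw [smul_comm, Finset.smul_sum]
  have hps := (posSemidef_sum Finset.univ fun t _ => hpos t).smul
    (a := (Fintype.card T : ℂ)⁻¹) (by positivity)
  obtain ⟨τ, hτ, h⟩ := PosSemidef.exists_isState_smul hps
  refine ⟨τ, hτ, ?_⟩
  rw [heq, h, hps.ofReal_trace_re, trace_smul, trace_sum]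
  simp_rw [htr]
  simp

end Tomography

theorem sum_single_kronecker {X Y : Type*} [Fintype Y] [DecidableEq X] [DecidableEq Y]
    (x x' : X) : ∑ y : Y, single (x', y) (x, y) (1 : ℂ) =
      kroneckerMap (fun x y => x * y) (single x' x (1 : ℂ)) (1 : Matrix Y Y ℂ) := by
  ext p q
  rcases p with ⟨p₁, p₂⟩
  rcases q with ⟨q₁, q₂⟩
  by_cases h1 : x' = p₁ <;> by_cases h2 : x = q₁ <;>
    simp [Matrix.sum_apply, kroneckerMap_apply, Matrix.single_apply, Matrix.one_apply, h1, h2,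
      ite_and, eq_comm]

theorem star_trRight_apply {X Y : Type*} [Fintype Y] {D : Matrix (X × Y) (X × Y) ℂ} (hD : D.IsHermitian) (x x' : X) :
    star (trRight D x x') = trRight D x' x := by
  simp only [trRight, of_apply, star_sum]
  exact Finset.sum_congr rfl fun y _ => hD.apply _ _

theorem norm_trRight_apply_le {X Y : Type*} [Fintype Y] {D : Matrix (X × Y) (X × Y) ℂ} {v : ℝ} (hD : ∀ b b', ‖D b b'‖ ≤ v)
    (x x' : X) : ‖trRight D x x'‖ ≤ Fintype.card Y * v := by
  refine (norm_sum_le _ _).trans ((Finset.sum_le_sum fun y _ => hD _ _).trans (le_of_eq ?_))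
  simp

theorem sum_trRight_dual_smul {X Y Z : Type*} [Fintype Y] [Fintype Z] [DecidableEq X]
    [DecidableEq Y] {E D : Z → Matrix (X × Y) (X × Y) ℂ}
    (hdual : ∀ b b', ∑ z, D z b b' • E z = single b' b 1) (x x' : X) :
    ∑ z, trRight (D z) x x' • E z =
      kroneckerMap (fun x y => x * y) (single x' x (1 : ℂ)) (1 : Matrix Y Y ℂ) := by
  rw [← sum_single_kronecker]
  simp only [trRight, of_apply, Finset.sum_smul]
  rw [Finset.sum_comm]
  exact Finset.sum_congr rfl fun y _ => hdual _ _

/-- The result acts on `X` alone. When `μ` is the `(x, x')` entry of `1/d_X` it is traceless, which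
makes distinct registers uncorrelated. -/
theorem sum_centered_dual_smul {X Y Z : Type*} [Fintype Y] [Fintype Z] [DecidableEq X]
    [DecidableEq Y] {E D : Z → Matrix (X × Y) (X × Y) ℂ} (hE1 : ∑ z, E z = 1)
    (hdual : ∀ b b', ∑ z, D z b b' • E z = single b' b 1) (x x' : X) (μ : ℂ) :
    ∑ z, (trRight (D z) x x' - μ) • E z =
      kroneckerMap (fun x y => x * y) (single x' x (1 : ℂ) - μ • 1) (1 : Matrix Y Y ℂ) := by
  simp only [sub_smul, Finset.sum_sub_distrib, sum_trRight_dual_smul hdual]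
  rw [← Finset.smul_sum, hE1]
  ext p q
  by_cases h : p.2 = q.2 <;> simp [kroneckerMap_apply, Matrix.one_apply, Prod.ext_iff, h]

/-! ### Second moments of exchangeable outcomes and of the input marginal -/

section Moments

variable {A B J Z : Type*} [Fintype A] [Fintype B] [Fintype J] [DecidableEq J]
  [Fintype Z] {E : Z → Matrix B B ℂ} {ω : Matrix (A × (J → B)) (A × (J → B)) ℂ}

theorem sum_outcomeProb_mul_norm_sq_le (hω : ω.PosSemidef)
    (hperm : ∀ (s : Equiv.Perm J) a b a' b', ω (a, b ∘ s) (a', b' ∘ s) = ω (a, b) (a', b'))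
    (hE : ∀ z, (E z).PosSemidef) (h1 : ∑ z : J → Z, outcomeProb ω E z = 1)
    {x : Z → ℂ} {v : ℝ} (hx : ∀ z, ‖x z‖ ≤ v) (c : J → ℝ) (hc : ∑ j, c j = 0) :
    ∑ z : J → Z, outcomeProb ω E z * ‖∑ j, c j * x (z j)‖ ^ 2 ≤ 2 * v ^ 2 * ∑ j, c j ^ 2 := by
  have hp := outcomeProb_nonneg hω hE
  have hbound : ∀ a b : Z, ‖x a * star (x b)‖ ≤ v ^ 2 := by
    intro a b
    rw [norm_mul, norm_star, pow_two]
    exact mul_le_mul (hx a) (hx b) (norm_nonneg _) ((norm_nonneg _).trans (hx a))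
  have hF : ∀ F : (J → Z) → ℂ, (∀ z, ‖F z‖ ≤ v ^ 2) →
      ‖∑ z, (outcomeProb ω E z : ℂ) * F z‖ ≤ v ^ 2 := by
    intro F hF
    calc _ ≤ ∑ z, outcomeProb ω E z * v ^ 2 := by
          refine (norm_sum_le _ _).trans (Finset.sum_le_sum fun z _ => ?_)
          rw [norm_mul, Complex.norm_real, Real.norm_of_nonneg (hp z)]
          exact mul_le_mul_of_nonneg_left (hF z) (hp z)
      _ = v ^ 2 := by rw [← Finset.sum_mul, h1, one_mul]
  -- Permutations act transitively on ordered pairs of distinct registers.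
  have hpair : ∀ i j, i ≠ j → ∀ i' j', i' ≠ j' →
      ∑ z : J → Z, (outcomeProb ω E z : ℂ) * (x (z i) * star (x (z j))) =
        ∑ z : J → Z, (outcomeProb ω E z : ℂ) * (x (z i') * star (x (z j'))) := by
    intro i j h i' j' h'
    obtain ⟨s, rfl, rfl⟩ := exists_perm_pair h h'
    rw [← sum_comp_perm s]
    exact Finset.sum_congr rfl fun z _ => by rw [outcomeProb_comp_perm hperm]; rfl
  have hV : ∀ i : J, ∑ z : J → Z, outcomeProb ω E z * ‖x (z i)‖ ^ 2 ≤ v ^ 2 := by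
    intro i
    calc _ ≤ ∑ z : J → Z, outcomeProb ω E z * v ^ 2 := by
          refine Finset.sum_le_sum fun z _ => mul_le_mul_of_nonneg_left ?_ (hp z)
          exact pow_le_pow_left₀ (norm_nonneg _) (hx _) 2
      _ = v ^ 2 := by rw [← Finset.sum_mul, h1, one_mul]
  by_cases hex : ∃ i j : J, i ≠ j
  · obtain ⟨i, j, hij⟩ := hex
    exact sum_mul_norm_sum_sq_le (ξ := fun j (z : J → Z) => x (z j))
      (fun i' j' h' => hpair i' j' h' i j hij) (hF _ fun z => hbound _ _) hV c (by simp [hc])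
  -- With at most one register there are no pairs, so the common correlation may be taken to be
  -- zero.
  · push Not at hex
    exact sum_mul_norm_sum_sq_le (ξ := fun j (z : J → Z) => x (z j)) (f := 0)
      (fun i' j' h' => absurd (hex i' j') h') (by simpa using sq_nonneg v) hV c (by simp)

end Moments

section Marginal

variable {A X Y J Z : Type*} [Fintype X] [Fintype Y] [DecidableEq A] [DecidableEq X]
  [DecidableEq Y] [Fintype J] [DecidableEq J] [Fintype Z] {E : Z → Matrix (X × Y) (X × Y) ℂ}
  {ω : Matrix (A × (J → X × Y)) (A × (J → X × Y)) ℂ} {c : ℂ}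

theorem sum_prod_smul_contract
    (hω : ∀ a a' (x x' : J → X), ∑ y : J → Y,
      ω (a, fun j => (x j, y j)) (a', fun j => (x' j, y j)) =
        if a = a' ∧ x = x' then c else 0) (g : J → Z → ℂ) (R : J → Matrix X X ℂ)
    (hg : ∀ j, ∑ z, g j z • E z = kroneckerMap (fun x y => x * y) (R j) (1 : Matrix Y Y ℂ)) :
    ∑ z : J → Z, (∏ j, g j (z j)) • contract ω (fun j => E (z j)) =
      (c * ∏ j, (R j).trace) • 1 := by
  rw [sum_contract, funext hg]
  exact contract_kronecker_one hω R

theorem sum_contract_eq (hE1 : ∑ z, E z = 1)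
    (hω : ∀ a a' (x x' : J → X), ∑ y : J → Y,
      ω (a, fun j => (x j, y j)) (a', fun j => (x' j, y j)) =
        if a = a' ∧ x = x' then c else 0) :
    ∑ z : J → Z, contract ω (fun j => E (z j)) =
      (c * (Fintype.card X : ℂ) ^ Fintype.card J) • 1 := by
  have := sum_prod_smul_contract hω (E := E) (fun _ _ => 1) (fun _ => 1) (fun j => by
    simp only [one_smul, hE1]
    exact (kroneckerMap_one_one _ (by simp) (by simp) (by simp)).symm)
  simpa using this

theorem sum_outcomeProb_mul_norm_sum_sq_le [Fintype A] (hpos : ω.PosSemidef)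
    (hE : ∀ z, (E z).PosSemidef) (hE1 : ∑ z, E z = 1)
    (h1 : ∑ z : J → Z, outcomeProb ω E z = 1)
    (hω : ∀ a a' (x x' : J → X), ∑ y : J → Y,
      ω (a, fun j => (x j, y j)) (a', fun j => (x' j, y j)) =
        if a = a' ∧ x = x' then c else 0)
    {g : Z → ℂ} {v : ℝ} (hg : ∀ z, ‖g z‖ ≤ v) {R R' : Matrix X X ℂ}
    (hR : ∑ z, g z • E z = kroneckerMap (fun x y => x * y) R (1 : Matrix Y Y ℂ))
    (hR' : ∑ z, star (g z) • E z = kroneckerMap (fun x y => x * y) R' (1 : Matrix Y Y ℂ))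
    (hR0 : R.trace = 0) (b : J → ℝ) :
    ∑ z : J → Z, outcomeProb ω E z * ‖∑ j, b j * g (z j)‖ ^ 2 ≤ 2 * v ^ 2 * ∑ j, b j ^ 2 := by
  have hp := outcomeProb_nonneg hpos hE
  refine sum_mul_norm_sum_sq_le (ξ := fun j (z : J → Z) => g (z j)) (f := 0) ?_
    (by simpa using sq_nonneg v) ?_ b (by simp)
  · intro i j hij
    -- Placing `g` at `i` and its conjugate at `j` makes the correlation a multiple of `R.trace`,
    -- hence zero.
    have h := congrArg trace (sum_prod_smul_contract hω (E := E)
      (fun k => if k = i then g else if k = j then fun z => star (g z) else fun _ => 1)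
      (fun k => if k = i then R else if k = j then R' else 1) (fun k => by
        by_cases hi : k = i
        · simp only [if_pos hi, hR]
        · by_cases hj : k = j
          · simp only [if_neg hi, if_pos hj, hR']
          · simp only [if_neg hi, if_neg hj, one_smul, hE1]
            exact (kroneckerMap_one_one _ (by simp) (by simp) (by simp)).symm))
    rw [Finset.prod_eq_zero (Finset.mem_univ i) (by simp [hR0]), mul_zero, zero_smul,
      trace_zero, trace_sum] at h
    rw [← h]
    refine Finset.sum_congr rfl fun z _ => ?_
    rw [trace_smul, ofReal_outcomeProb hpos hE, smul_eq_mul, mul_comm]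
    congr 1
    rw [Finset.prod_eq_mul i j hij]
    · simp [hij.symm]
    · intro k _ hk
      simp [hk.1, hk.2]
    · simp
    · simp
  · intro i
    calc _ ≤ ∑ z : J → Z, outcomeProb ω E z * v ^ 2 := by
          refine Finset.sum_le_sum fun z _ => mul_le_mul_of_nonneg_left ?_ (hp z)
          exact pow_le_pow_left₀ (norm_nonneg _) (hg _) 2
      _ = v ^ 2 := by rw [← Finset.sum_mul, h1, one_mul]

end Marginal

theorem sum_sumElim {S T Z V : Type*} [Fintype S] [Fintype T] [DecidableEq S] [DecidableEq T]
    [Fintype Z] [AddCommMonoid V] (F : (S ⊕ T → Z) → V) :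
    ∑ z, F z = ∑ u : S → Z, ∑ w : T → Z, F (Sum.elim u w) := by
  rw [← (Equiv.sumArrowEquivProdArrow S T Z).symm.sum_comp, Fintype.sum_prod_type]
  rfl

/-- The constant of the finite de Finetti theorem for systems of dimensions `x` and `y`. -/
noncomputable def deFinettiConst (x y : ℕ) : ℝ :=
  -- The outer factors are the costs in `traceBounded_of_sum_sq_le` and `exists_state_trRight_eq`.
  -- Under each root stands the number of matrix entries times a variance bound `2 v²`, with `v`
  -- bounding the entries of `D`, respectively of its centred partial trace.
  (x * y) * √((x * y) ^ 2 * (2 * (2 * (x * y)) ^ 2)) +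
    2 * x * √(x ^ 2 * (2 * (y * (2 * (x * y)) + 1) ^ 2))

/-- The average of the dual frame over a string of outcomes. -/
noncomputable def dualMean {R B Z : Type*} [Fintype R] (D : Z → Matrix B B ℂ) (u : R → Z) :
    Matrix B B ℂ :=
  (Fintype.card R : ℂ)⁻¹ • ∑ s, D (u s)

theorem dualMean_apply {R B Z : Type*} [Fintype R] (D : Z → Matrix B B ℂ) (u : R → Z) (b b' : B) :
    dualMean D u b b' = (Fintype.card R : ℂ)⁻¹ * ∑ s, D (u s) b b' := by
  simp [dualMean, Matrix.sum_apply]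

theorem isHermitian_dualMean {R B Z : Type*} [Fintype R] {D : Z → Matrix B B ℂ}
    (hD : ∀ z, (D z).IsHermitian) (u : R → Z) : (dualMean D u).IsHermitian := by
  rw [dualMean, IsHermitian, conjTranspose_smul, conjTranspose_sum]
  simp [(hD _).eq]

/-! ### The finite de Finetti approximation -/

section Core

variable {A X Y S T Z : Type*} [Fintype A] [Fintype X] [Fintype Y]
  [Fintype S] [Fintype T] [DecidableEq S] [DecidableEq T] [Nonempty T]
  [Fintype Z] {E D : Z → Matrix (X × Y) (X × Y) ℂ}
  {ω : Matrix (A × (S ⊕ T → X × Y)) (A × (S ⊕ T → X × Y)) ℂ}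

theorem sum_outcomeProb_mul_dualMean_sub_le [Nonempty S] (hω : ω.PosSemidef)
    (hperm : ∀ (s : Equiv.Perm (S ⊕ T)) a b a' b',
      ω (a, b ∘ s) (a', b' ∘ s) = ω (a, b) (a', b'))
    (hE : ∀ z, (E z).PosSemidef) (h1 : ∑ z : S ⊕ T → Z, outcomeProb ω E z = 1) {v : ℝ}
    (hD : ∀ z b b', ‖D z b b'‖ ≤ v) (b b' : X × Y) :
    ∑ u : S → Z, ∑ w : T → Z, outcomeProb ω E (Sum.elim u w) *
      ‖dualMean D w b b' - dualMean D u b b'‖ ^ 2 ≤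
        2 * v ^ 2 * (1 / Fintype.card S + 1 / Fintype.card T) := by
  have h := sum_outcomeProb_mul_norm_sq_le hω hperm hE h1 (x := fun z => D z b b')
    (fun z => hD z b b')
    -- These coefficients sum to zero, and their squares sum to `1/|S| + 1/|T|`.
    (Sum.elim (fun _ => -(Fintype.card S : ℝ)⁻¹) (fun _ => (Fintype.card T : ℝ)⁻¹)) (by simp)
  rw [sum_sumElim] at h
  simp only [Fintype.sum_sum_type, Sum.elim_inl, Sum.elim_inr] at h
  convert h using 1
  · refine Finset.sum_congr rfl fun u _ => Finset.sum_congr rfl fun w _ => ?_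
    congr 3
    rw [dualMean_apply, dualMean_apply]
    push_cast
    simp only [neg_mul, Finset.sum_neg_distrib, ← Finset.mul_sum]
    ring
  · congr 1
    simp only [even_two, Even.neg_pow, Finset.sum_const, Finset.card_univ, nsmul_eq_mul]
    field_simp

theorem sum_outcomeProb_mul_trRight_dualMean_sub_le [DecidableEq A] [DecidableEq X]
    [DecidableEq Y] [Nonempty X] (hω : ω.PosSemidef)
    (hE : ∀ z, (E z).PosSemidef) (hE1 : ∑ z, E z = 1) (hDh : ∀ z, (D z).IsHermitian)
    (hdual : ∀ b b', ∑ z, D z b b' • E z = single b' b 1)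
    (h1 : ∑ z : S ⊕ T → Z, outcomeProb ω E z = 1) {c : ℂ}
    (hmarg : ∀ a a' (x x' : S ⊕ T → X), ∑ y : S ⊕ T → Y,
      ω (a, fun j => (x j, y j)) (a', fun j => (x' j, y j)) =
        if a = a' ∧ x = x' then c else 0) {v : ℝ}
    (hD : ∀ z b b', ‖D z b b'‖ ≤ v) (x x' : X) :
    ∑ u : S → Z, ∑ w : T → Z, outcomeProb ω E (Sum.elim u w) *
      ‖trRight (dualMean D w) x x' - ((Fintype.card X : ℂ)⁻¹ • (1 : Matrix X X ℂ)) x x'‖ ^ 2 ≤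
        2 * (Fintype.card Y * v + 1) ^ 2 * (1 / Fintype.card T) := by
  set μ : ℂ := ((Fintype.card X : ℂ)⁻¹ • (1 : Matrix X X ℂ)) x x' with hμ
  have hμ' : μ = if x = x' then (Fintype.card X : ℂ)⁻¹ else 0 := by
    simp [hμ, Matrix.one_apply]
  have hμs : star μ = μ := by
    rw [hμ']; split_ifs <;> simp
  have hμn : ‖μ‖ ≤ 1 := by
    rw [hμ']
    split_ifs
    · rw [norm_inv, Complex.norm_natCast]
      exact inv_le_one_of_one_le₀ (by exact_mod_cast Fintype.card_pos (α := X))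
    · simp
  have h := sum_outcomeProb_mul_norm_sum_sq_le hω hE hE1 h1 hmarg
    (g := fun z => trRight (D z) x x' - μ) (v := Fintype.card Y * v + 1)
    (fun z => (norm_sub_le _ _).trans (add_le_add (norm_trRight_apply_le (hD z) x x') hμn))
    (sum_centered_dual_smul hE1 hdual x x' μ) (by
      simp only [star_sub, star_trRight_apply (hDh _), hμs]
      exact sum_centered_dual_smul hE1 hdual x' x μ)
    (by
      rw [trace_sub, trace_smul, trace_one, hμ']
      by_cases hx : x = x'
      · subst hx
        simp
      · rw [trace_single_eq_of_ne _ _ _ (Ne.symm hx)]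
        simp [hx])
    -- Only the average over `T` matters here, because `τ u` is a conditional mean over that block.
    (Sum.elim (fun _ => 0) (fun _ => (Fintype.card T : ℝ)⁻¹))
  rw [sum_sumElim] at h
  simp only [Fintype.sum_sum_type, Sum.elim_inl, Sum.elim_inr] at h
  convert h using 1
  · refine Finset.sum_congr rfl fun u _ => Finset.sum_congr rfl fun w _ => ?_
    congr 3
    simp only [trRight, of_apply, dualMean_apply, ← Finset.mul_sum, Finset.sum_sub_distrib]
    rw [Finset.sum_comm]
    have : (Fintype.card T : ℂ) ≠ 0 := by simp
    simp
    field_simp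
  · congr 1
    simp
    field_simp

theorem exists_deFinetti [DecidableEq A] [DecidableEq X] [DecidableEq Y] [Nonempty A] [Nonempty X]
    [Nonempty Y] [Nonempty S] (hω : ω.PosSemidef)
    (hperm : ∀ (s : Equiv.Perm (S ⊕ T)) a b a' b',
      ω (a, b ∘ s) (a', b' ∘ s) = ω (a, b) (a', b'))
    (hmarg : ∀ a a' (x x' : S ⊕ T → X), ∑ y : S ⊕ T → Y,
      ω (a, fun j => (x j, y j)) (a', fun j => (x' j, y j)) =
        if a = a' ∧ x = x' then
          ((Fintype.card A : ℂ) * (Fintype.card X : ℂ) ^ Fintype.card (S ⊕ T))⁻¹ else 0)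
    (hE : ∀ z, (E z).PosSemidef) (hE1 : ∑ z, E z = 1) (hDh : ∀ z, (D z).IsHermitian)
    (hD : ∀ z b b', ‖D z b b'‖ ≤ 2 * Fintype.card (X × Y))
    (hdual : ∀ b b', ∑ z, D z b b' • E z = single b' b 1) (i : S ⊕ T) :
    ∃ (M : (S → Z) → Matrix A A ℂ) (φ : (S → Z) → Matrix (X × Y) (X × Y) ℂ),
      (∀ u, (M u).PosSemidef) ∧ ∑ u, M u = (Fintype.card A : ℂ)⁻¹ • 1 ∧ (∀ u, IsState (φ u)) ∧
      (∀ u, trRight (φ u) = (Fintype.card X : ℂ)⁻¹ • (1 : Matrix X X ℂ)) ∧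
      TraceBounded ((of fun p q => contract ω
          (Function.update (fun _ => 1) i (single q.2 p.2 1)) p.1 q.1) -
          ∑ u, kroneckerMap (fun x y => x * y) (M u) (φ u))
        (deFinettiConst (Fintype.card X) (Fintype.card Y) *
          √(1 / Fintype.card S + 1 / Fintype.card T)) := by
  set ε : ℝ := 1 / Fintype.card S + 1 / Fintype.card T with hε
  have hε0 : 0 ≤ ε := by positivity
  let P : (S ⊕ T → Z) → Matrix A A ℂ := fun z => contract ω (fun j => E (z j))
  have hP : ∀ z, (P z).PosSemidef := fun z => posSemidef_contract hω fun j => hE _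
  have hPsum : ∑ z, P z = (Fintype.card A : ℂ)⁻¹ • 1 := by
    rw [sum_contract_eq hE1 hmarg, mul_inv, mul_assoc, inv_mul_cancel₀, mul_one]
    exact pow_ne_zero _ (by simp)
  have hp0 : ∀ z : S ⊕ T → Z, 0 ≤ outcomeProb ω E z := outcomeProb_nonneg hω hE
  have h1 : ∑ z : S ⊕ T → Z, outcomeProb ω E z = 1 := by
    have := congrArg (fun R : Matrix A A ℂ => R.trace.re) hPsum
    have h : ∑ z, (P z).trace.re = 1 := by simpa [trace_sum, trace_smul] using this
    exact h
  choose τ hτ hτeq using exists_isState_conditional (T := T) hω hE hE1 hDh hdual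
  let q : (S → Z) → ℝ := fun u => ∑ w : T → Z, outcomeProb ω E (Sum.elim u w)
  have hq0 : ∀ u, 0 ≤ q u := fun u => Finset.sum_nonneg fun w _ => hp0 _
  have hq1 : ∑ u, q u = 1 := by rw [← h1, sum_sumElim]
  have hτentry : ∀ b b' u, ((∑ w : T → Z, outcomeProb ω E (Sum.elim u w) : ℝ) : ℂ) * τ u b b' =
      ∑ w : T → Z, (outcomeProb ω E (Sum.elim u w) : ℂ) * dualMean D w b b' := by
    intro b b' u
    have := congrFun (congrFun (hτeq u) b) b'
    rw [Matrix.sum_apply] at this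
    exact this
  have hτtr : ∀ x x' u, ((∑ w : T → Z, outcomeProb ω E (Sum.elim u w) : ℝ) : ℂ) *
      trRight (τ u) x x' =
      ∑ w : T → Z, (outcomeProb ω E (Sum.elim u w) : ℂ) * trRight (dualMean D w) x x' := by
    intro x x' u
    simp only [trRight, of_apply, Finset.mul_sum]
    rw [Finset.sum_comm]
    refine Finset.sum_congr rfl fun y _ => ?_
    rw [hτentry]
  -- Hilbert–Schmidt errors of the two replacements; the bounds `hm₁` and `hm₂` hold only on average
  -- over `u`.
  let δ₁ : (S → Z) → ℝ := fun u => √(∑ b, ∑ b', ‖(dualMean D u - τ u) b b'‖ ^ 2)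
  let δ₂ : (S → Z) → ℝ := fun u =>
    √(∑ x, ∑ x', ‖((Fintype.card X : ℂ)⁻¹ • (1 : Matrix X X ℂ) - trRight (τ u)) x x'‖ ^ 2)
  have hδ₁ : ∀ u, ∑ b, ∑ b', ‖(dualMean D u - τ u) b b'‖ ^ 2 = δ₁ u ^ 2 := fun u =>
    (Real.sq_sqrt (by positivity)).symm
  have hδ₂ : ∀ u, ∑ x, ∑ x', ‖((Fintype.card X : ℂ)⁻¹ • (1 : Matrix X X ℂ) -
      trRight (τ u)) x x'‖ ^ 2 = δ₂ u ^ 2 := fun u => (Real.sq_sqrt (by positivity)).symm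
  have hm₁ : ∑ u, q u * δ₁ u ^ 2 ≤ (Fintype.card X * Fintype.card Y : ℝ) ^ 2 *
      (2 * (2 * (Fintype.card X * Fintype.card Y)) ^ 2) * ε := by
    simp_rw [← hδ₁, Finset.mul_sum]
    rw [Finset.sum_comm]
    have : ∀ b b', ∑ u, q u * ‖(dualMean D u - τ u) b b'‖ ^ 2 ≤
        2 * (2 * Fintype.card (X × Y) : ℝ) ^ 2 * ε := by
      intro b b'
      refine le_trans ?_ (sum_outcomeProb_mul_dualMean_sub_le hω hperm hE h1 hD b b')
      simp_rw [Matrix.sub_apply, norm_sub_rev (dualMean D _ b b') (τ _ b b')]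
      exact sum_mul_norm_sub_sq_le (fun u w => hp0 _) (hτentry b b')
    calc _ ≤ ∑ _b : X × Y, ∑ _b' : X × Y, 2 * (2 * Fintype.card (X × Y) : ℝ) ^ 2 * ε := by
          refine Finset.sum_le_sum fun b _ => ?_
          rw [Finset.sum_comm]
          exact Finset.sum_le_sum fun b' _ => this b b'
      _ = _ := by
          simp only [Finset.sum_const, Finset.card_univ, nsmul_eq_mul, Fintype.card_prod]
          push_cast
          ring
  have hm₂ : ∑ u, q u * δ₂ u ^ 2 ≤ (Fintype.card X : ℝ) ^ 2 *
      (2 * (Fintype.card Y * (2 * (Fintype.card X * Fintype.card Y)) + 1) ^ 2) * ε := by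
    simp_rw [← hδ₂, Finset.mul_sum]
    rw [Finset.sum_comm]
    have : ∀ x x', ∑ u, q u * ‖((Fintype.card X : ℂ)⁻¹ • (1 : Matrix X X ℂ) -
        trRight (τ u)) x x'‖ ^ 2 ≤
        2 * (Fintype.card Y * (2 * Fintype.card (X × Y)) + 1 : ℝ) ^ 2 * ε := by
      intro x x'
      refine le_trans ?_ ((sum_outcomeProb_mul_trRight_dualMean_sub_le hω hE hE1 hDh hdual h1
        hmarg hD x x').trans (mul_le_mul_of_nonneg_left (?_ : _ ≤ ε) (by positivity)))
      · simp_rw [Matrix.sub_apply, norm_sub_rev _ (trRight (τ _) x x')]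
        exact sum_mul_norm_sub_sq_le (fun u w => hp0 _) (hτtr x x')
      · rw [hε]
        exact le_add_of_nonneg_left (by positivity)
    calc _ ≤ ∑ _x : X, ∑ _x' : X,
          2 * (Fintype.card Y * (2 * Fintype.card (X × Y)) + 1 : ℝ) ^ 2 * ε := by
          refine Finset.sum_le_sum fun b _ => ?_
          rw [Finset.sum_comm]
          exact Finset.sum_le_sum fun b' _ => this b b'
      _ = _ := by
          simp only [Finset.sum_const, Finset.card_univ, nsmul_eq_mul, Fintype.card_prod]
          push_cast
          ring
  choose φ hφ hφtr hφb using fun u =>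
    exists_state_trRight_eq (hτ u) (Real.sqrt_nonneg _) (hδ₂ u).le
  let M : (S → Z) → Matrix A A ℂ := fun u => ∑ w : T → Z, P (Sum.elim u w)
  have hM : ∀ u, (M u).PosSemidef := fun u => posSemidef_sum _ fun w _ => hP _
  have hMtr : ∀ u, (M u).trace.re = q u := by
    intro u
    simp only [M, trace_sum, Complex.re_sum]
    rfl
  refine ⟨M, φ, hM, ?_, hφ, hφtr, ?_⟩
  · rw [← hPsum, sum_sumElim]
  -- An exact identity: by symmetry register `i` may be exchanged for any `s` in `S`, where the dual
  -- frame inverts the measurement; averaging over `s` yields `dualMean`.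
  have hlhs : (of fun p q => contract ω
      (Function.update (fun _ => 1) i (single q.2 p.2 1)) p.1 q.1) =
      ∑ u, kroneckerMap (fun x y => x * y) (M u) (dualMean D u) := by
    ext ⟨a, b⟩ ⟨a', b'⟩
    rw [of_apply, Matrix.sum_apply]
    have hs : ∀ s : S, ∑ u, M u a a' * D (u s) b b' = contract ω
        (Function.update (fun _ => 1) i (single b' b 1)) a a' := by
      intro s
      rw [contract_update_eq hperm i (Sum.inl s), ← sum_dual_smul_contract hE1 hdual,
        sum_sumElim, Matrix.sum_apply]
      refine Finset.sum_congr rfl fun u _ => ?_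
      simp only [M, P, Matrix.sum_apply, Finset.sum_mul, Matrix.smul_apply, Sum.elim_inl,
        smul_eq_mul]
      exact Finset.sum_congr rfl fun w _ => mul_comm _ _
    simp only [kroneckerMap_apply, dualMean_apply]
    have : ∑ u, M u a a' * ((Fintype.card S : ℂ)⁻¹ * ∑ s, D (u s) b b') =
        (Fintype.card S : ℂ)⁻¹ * ∑ s, ∑ u, M u a a' * D (u s) b b' := by
      rw [Finset.sum_comm, Finset.mul_sum]
      refine Finset.sum_congr rfl fun u _ => ?_
      rw [← Finset.mul_sum]
      ring
    rw [this]
    simp_rw [hs]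
    simp
  rw [hlhs, ← Finset.sum_sub_distrib]
  have hb : ∀ u, TraceBounded (kroneckerMap (fun x y => x * y) (M u) (dualMean D u) -
      kroneckerMap (fun x y => x * y) (M u) (φ u))
      (q u * (Fintype.card (X × Y) * δ₁ u + 2 * Fintype.card X * δ₂ u)) := by
    intro u
    have h := ((traceBounded_of_sum_sq_le ((isHermitian_dualMean hDh u).sub (hτ u).1.1)
      (Real.sqrt_nonneg _) (hδ₁ u).le).add (hφb u)).kronecker (hM u)
    rw [hMtr] at h
    convert h using 1
    ext p p'
    simp [kroneckerMap_apply]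
    ring
  refine (TraceBounded.sum Finset.univ fun u _ => hb u).mono ?_
  -- Cauchy–Schwarz passes from mean squares to means, which is where the square root in the rate
  -- appears.
  have e₁ := sum_mul_le_sqrt hq0 hq1 hm₁
  have e₂ := sum_mul_le_sqrt hq0 hq1 hm₂
  rw [Real.sqrt_mul (by positivity)] at e₁ e₂
  calc _ = (Fintype.card X * Fintype.card Y : ℝ) * ∑ u, q u * δ₁ u +
        2 * Fintype.card X * ∑ u, q u * δ₂ u := by
        rw [Finset.mul_sum, Finset.mul_sum, ← Finset.sum_add_distrib]
        refine Finset.sum_congr rfl fun u _ => ?_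
        rw [Fintype.card_prod]
        push_cast
        ring
    _ ≤ _ := add_le_add (mul_le_mul_of_nonneg_left e₁ (by positivity))
        (mul_le_mul_of_nonneg_left e₂ (by positivity))
    _ = _ := by
        rw [deFinettiConst]
        ring

end Core

/-! ### Choi matrices of symmetric channels and register bookkeeping -/

theorem posSemidef_maxEntangled (I : Type*) [Fintype I] [DecidableEq I] :
    (maxEntangled I).PosSemidef := by
  have h : maxEntangled I = (Fintype.card I : ℂ)⁻¹ •
      vecMulVec (fun p : I × I => if p.1 = p.2 then (1 : ℂ) else 0)
        (star fun p : I × I => if p.1 = p.2 then (1 : ℂ) else 0) := by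
    ext p q
    by_cases h1 : p.1 = p.2 <;> by_cases h2 : q.1 = q.2 <;>
      simp [maxEntangled, vecMulVec_apply, h1, h2]
  rw [h]
  exact (posSemidef_vecMulVec_self_star _).smul (by positivity)

theorem posSemidef_choi {I O : Type*} [Fintype I] [DecidableEq I] [Fintype O]
    {Φ : Matrix I I ℂ →ₗ[ℂ] Matrix O O ℂ} (hΦ : IsChannel Φ) : (choi Φ).PosSemidef := by
  let e := Fintype.equivFin I
  have h := hΦ.completelyPositive _ _
    ((posSemidef_maxEntangled I).submatrix (fun p : Fin (Fintype.card I) × I => (e.symm p.1, p.2)))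
  convert h.submatrix (fun p : I × O => (e p.1, p.2)) using 1
  ext p q
  simp [choi, ampl]

theorem sum_choi {I O : Type*} [Fintype I] [DecidableEq I] [Fintype O]
    {Φ : Matrix I I ℂ →ₗ[ℂ] Matrix O O ℂ} (hΦ : IsChannel Φ) (i i' : I) :
    ∑ o, choi Φ (i, o) (i', o) = if i = i' then (Fintype.card I : ℂ)⁻¹ else 0 := by
  have h := hΦ.tracePreserving (single i i' 1)
  simp only [choi_apply, ← Finset.mul_sum]
  have h2 : ∑ o, Φ (single i i' 1) o o = (single i i' (1 : ℂ)).trace := h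
  rw [h2]
  split_ifs with hi
  · subst hi
    simp
  · simp [trace_single_eq_of_ne _ _ _ hi]

theorem trace_choi {I O : Type*} [Fintype I] [DecidableEq I] [Nonempty I] [Fintype O]
    {Φ : Matrix I I ℂ →ₗ[ℂ] Matrix O O ℂ} (hΦ : IsChannel Φ) : (choi Φ).trace = 1 := by
  simp only [trace, diag_apply, Fintype.sum_prod_type, sum_choi hΦ, if_true]
  simp

/-- The permutation pulls a matrix unit with permuted indices back to a matrix unit, so symmetry of
the map becomes invariance of the Choi entries. -/
theorem choi_comp_perm {n : ℕ} {A X Y : Type*} [Fintype A] [Fintype X] [DecidableEq A]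
    [DecidableEq X]
    {Q : Matrix (A × (Fin n → X)) (A × (Fin n → X)) ℂ →ₗ[ℂ] Matrix (Fin n → Y) (Fin n → Y) ℂ}
    (hQ : IsSymmetricMap Q) (s : Equiv.Perm (Fin n)) (a a' : A) (x x' : Fin n → X)
    (y y' : Fin n → Y) :
    choi Q ((a, x ∘ s), y ∘ s) ((a', x' ∘ s), y' ∘ s) = choi Q ((a, x), y) ((a', x'), y') := by
  have h := congrFun (congrFun (hQ s (single (a, x ∘ s) (a', x' ∘ s) 1)) y) y'
  have h2 : (single (a, x ∘ s) (a', x' ∘ s) (1 : ℂ)).submatrix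
      (fun p : A × (Fin n → X) => (p.1, p.2 ∘ s)) (fun p => (p.1, p.2 ∘ s)) =
      single (a, x) (a', x') 1 := by
    ext p q
    simp [single_apply, Prod.ext_iff, s.surjective.injective_comp_right.eq_iff]
  rw [h2] at h
  rw [choi_apply, choi_apply, h]
  rfl

theorem posSemidef_keepAXY {n : ℕ} {A X Y : Type*} [Fintype X] [Fintype Y] (i : Fin n)
    {ω : Matrix ((A × (Fin n → X)) × (Fin n → Y)) ((A × (Fin n → X)) × (Fin n → Y)) ℂ}
    (hω : ω.PosSemidef) : (keepAXY i ω).PosSemidef := by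
  have : keepAXY i ω = ∑ u : {j : Fin n // j ≠ i} → X, ∑ v : {j : Fin n // j ≠ i} → Y,
      ω.submatrix (fun p : A × (X × Y) => ((p.1, ins i p.2.1 u), ins i p.2.2 v))
        (fun p => ((p.1, ins i p.2.1 u), ins i p.2.2 v)) := by
    ext p q
    simp [keepAXY, Matrix.sum_apply]
  rw [this]
  exact posSemidef_sum _ fun u _ => posSemidef_sum _ fun v _ => hω.submatrix _

theorem trace_keepAXY {n : ℕ} {A X Y : Type*} [Fintype A] [Fintype X] [Fintype Y] (i : Fin n)
    (ω : Matrix ((A × (Fin n → X)) × (Fin n → Y)) ((A × (Fin n → X)) × (Fin n → Y)) ℂ) :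
    (keepAXY i ω).trace = ω.trace := by
  simp only [trace, diag_apply, keepAXY, of_apply, Fintype.sum_prod_type]
  refine Finset.sum_congr rfl fun a _ => ?_
  rw [← (Equiv.funSplitAt i X).symm.sum_comp, Fintype.sum_prod_type]
  refine Finset.sum_congr rfl fun x _ => ?_
  rw [Finset.sum_comm]
  refine Finset.sum_congr rfl fun u _ => ?_
  rw [← (Equiv.funSplitAt i Y).symm.sum_comp, Fintype.sum_prod_type]
  rfl

theorem contract_submatrix {A B J J' : Type*} [Fintype B] [Fintype J] [DecidableEq J]
    [Fintype J'] [DecidableEq J'] (e : J' ≃ J) (ω : Matrix (A × (J → B)) (A × (J → B)) ℂ)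
    (G : J' → Matrix B B ℂ) :
    contract (ω.submatrix (fun p : A × (J' → B) => (p.1, p.2 ∘ e.symm))
      (fun p => (p.1, p.2 ∘ e.symm))) G = contract ω (G ∘ e.symm) := by
  ext a a'
  simp only [contract, of_apply]
  let f : (J' → B) ≃ (J → B) := e.arrowCongr (Equiv.refl B)
  refine Fintype.sum_equiv f _ _ fun b => Fintype.sum_equiv f _ _ fun b' => ?_
  rw [submatrix_apply]
  congr 1
  exact Fintype.prod_equiv e _ _ fun j => by simp [f]

/-- The matrix unit at register `i` selects one entry and the identities trace out the rest; its
indices are transposed because `contract` is a trace pairing. -/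
theorem contract_update_single {A B J : Type*} [Fintype B] [DecidableEq B] [Fintype J]
    [DecidableEq J] (ω : Matrix (A × (J → B)) (A × (J → B)) ℂ) (i : J) (b b' : B) (a a' : A) :
    contract ω (Function.update (fun _ => 1) i (single b' b 1)) a a' =
      ∑ u : {j : J // j ≠ i} → B,
        ω (a, (Equiv.funSplitAt i B).symm (b, u)) (a', (Equiv.funSplitAt i B).symm (b', u)) := by
  simp only [contract, of_apply]
  rw [← (Equiv.funSplitAt i B).symm.sum_comp, Fintype.sum_prod_type]
  have h : ∀ c c' u u', ∏ j, Function.update (fun _ => (1 : Matrix B B ℂ)) i (single b' b 1) j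
      ((Equiv.funSplitAt i B).symm (c', u') j) ((Equiv.funSplitAt i B).symm (c, u) j) =
      if c = b then if c' = b' then if u = u' then 1 else 0 else 0 else 0 := by
    intro c c' u u'
    rw [Fintype.prod_eq_mul_prod_subtype_ne _ i]
    have h1 : ∀ (k : {j // j ≠ i}) (d : B) (v : {j // j ≠ i} → B),
        (Equiv.funSplitAt i B).symm (d, v) k = v k := by
      intro k d v
      simp [Equiv.funSplitAt, Equiv.piSplitAt_symm_apply, k.2]
    have h2 : ∀ (d : B) (v : {j // j ≠ i} → B), (Equiv.funSplitAt i B).symm (d, v) i = d := by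
      intro d v
      simp [Equiv.funSplitAt, Equiv.piSplitAt_symm_apply]
    have h3 : ∀ k : {j // j ≠ i}, Function.update (fun _ => (1 : Matrix B B ℂ)) i
        (single b' b 1) k = 1 := fun k => Function.update_of_ne k.2 _ _
    simp only [h1, h2, h3, Function.update_self]
    have h4 : (∏ k, (1 : Matrix B B ℂ) (u' k) (u k)) = if u = u' then 1 else 0 := by
      simp [Matrix.one_apply, Finset.prod_ite_zero, funext_iff, eq_comm]
    rw [h4, single_apply]
    simp only [eq_comm (a := b'), eq_comm (a := b)]
    by_cases e1 : c = b <;> by_cases e2 : c' = b' <;> simp [e1, e2]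
  rw [Finset.sum_eq_single b]
  · refine Finset.sum_congr rfl fun u _ => ?_
    rw [← (Equiv.funSplitAt i B).symm.sum_comp, Fintype.sum_prod_type, Finset.sum_eq_single b']
    · simp only [h]
      simp
    · intro c' _ hc
      simp only [h]
      simp [hc]
    · simp
  · intro c _ hc
    refine Finset.sum_eq_zero fun u _ => ?_
    rw [← (Equiv.funSplitAt i B).symm.sum_comp, Fintype.sum_prod_type]
    simp only [h]
    simp [hc]
  · simp

/-- The operator `ω` on `A X₁ ⋯ X_n Y₁ ⋯ Y_n` as an operator on `A (X₁ Y₁) ⋯ (X_n Y_n)`. -/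
def pairRegisters {n : ℕ} {A X Y : Type*}
    (ω : Matrix ((A × (Fin n → X)) × (Fin n → Y)) ((A × (Fin n → X)) × (Fin n → Y)) ℂ) :
    Matrix (A × (Fin n → X × Y)) (A × (Fin n → X × Y)) ℂ :=
  ω.submatrix (fun p => ((p.1, fun i => (p.2 i).1), fun i => (p.2 i).2))
    (fun p => ((p.1, fun i => (p.2 i).1), fun i => (p.2 i).2))

theorem keepAXY_eq_contract {n : ℕ} {A X Y : Type*} [Fintype X] [Fintype Y] [DecidableEq X]
    [DecidableEq Y] (i : Fin n)
    (ω : Matrix ((A × (Fin n → X)) × (Fin n → Y)) ((A × (Fin n → X)) × (Fin n → Y)) ℂ) :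
    keepAXY i ω = of fun p q => contract (pairRegisters ω)
      (Function.update (fun _ => 1) i (single q.2 p.2 1)) p.1 q.1 := by
  ext ⟨a, b⟩ ⟨a', b'⟩
  rw [of_apply, contract_update_single, keepAXY, of_apply,
    ← (Equiv.arrowProdEquivProdArrow {j // j ≠ i} (fun _ => X) (fun _ => Y)).symm.sum_comp,
    Fintype.sum_prod_type]
  have h : ∀ (b : X × Y) (u : {j // j ≠ i} → X) (v : {j // j ≠ i} → Y),
      (fun k => ((Equiv.funSplitAt i (X × Y)).symm (b, (Equiv.arrowProdEquivProdArrow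
        {j // j ≠ i} (fun _ => X) (fun _ => Y)).symm (u, v)) k).1) = ins i b.1 u ∧
      (fun k => ((Equiv.funSplitAt i (X × Y)).symm (b, (Equiv.arrowProdEquivProdArrow
        {j // j ≠ i} (fun _ => X) (fun _ => Y)).symm (u, v)) k).2) = ins i b.2 v := by
    intro b u v
    constructor <;> funext k <;> by_cases hk : k = i <;>
      simp [ins, Equiv.funSplitAt, Equiv.piSplitAt_symm_apply, hk]
  refine Finset.sum_congr rfl fun u _ => Finset.sum_congr rfl fun v _ => ?_
  rw [pairRegisters, submatrix_apply]
  simp only [(h _ u v).1, (h _ u v).2]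

/-! ### Assembling the measure and the rate -/

theorem exists_measure_of_traceBounded {ι A X Y : Type*} [Fintype ι] [Fintype A] [Fintype X]
    [Fintype Y] [DecidableEq A] [DecidableEq X] [DecidableEq Y] [Nonempty A] [Nonempty X]
    {M : ι → Matrix A A ℂ} {φ : ι → Matrix (X × Y) (X × Y) ℂ}
    (hM : ∀ u, (M u).PosSemidef) (hM1 : ∑ u, M u = (Fintype.card A : ℂ)⁻¹ • 1)
    (hφ : ∀ u, IsState (φ u))
    (hφX : ∀ u, trRight (φ u) = (Fintype.card X : ℂ)⁻¹ • (1 : Matrix X X ℂ))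
    {R : Matrix (A × (X × Y)) (A × (X × Y)) ℂ} {c : ℝ}
    (h : TraceBounded (R - ∑ u, kroneckerMap (fun x y => x * y) (M u) (φ u)) c) :
    ∃ (G : Type) (_ : MeasurableSpace G) (M : VectorMeasure G (Matrix A A ℂ))
      (φ : G → Matrix (X × Y) (X × Y) ℂ),
      IsPOVM ((Fintype.card A : ℂ) • M) ∧ (∀ p q, Measurable fun g => φ g p q) ∧
      (∀ g, IsState (φ g)) ∧
      (∀ g, trRight (φ g) = (Fintype.card X : ℂ)⁻¹ • (1 : Matrix X X ℂ)) ∧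
      (∀ g, ∃ Φ : Matrix X X ℂ →ₗ[ℂ] Matrix Y Y ℂ, IsChannel Φ ∧ choi Φ = φ g) ∧
      IsSeparableState (tensorIntegral M φ) ∧ traceNorm (R - tensorIntegral M φ) ≤ c := by
  -- Enumerating the index type puts `G` in `Type`, whatever the universe of `ι`.
  let e := (Fintype.equivFin ι).symm
  have hsum : ∑ g, M (e g) = (Fintype.card A : ℂ)⁻¹ • 1 := by rw [e.sum_comp, hM1]
  have hA : (Fintype.card A : ℂ) ≠ 0 := by simp
  refine ⟨Fin (Fintype.card ι), inferInstance, sumDirac fun g => M (e g), fun g => φ (e g),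
    isPOVM_sumDirac (fun g => hM _) (by positivity) ?_, fun p q => measurable_of_finite _,
    fun g => hφ _, fun g => hφX _,
    fun g => ⟨ofChoi (φ (e g)), isChannel_ofChoi (hφ _).1 (hφX _), choi_ofChoi _⟩, ?_, ?_⟩
  · rw [hsum, smul_smul, mul_inv_cancel₀ hA, one_smul]
  · rw [tensorIntegral_sumDirac]
    refine isSeparableState_sum (fun g => hM _) ?_ fun g => hφ _
    rw [hsum]
    simp [trace_smul]
  · rw [tensorIntegral_sumDirac, e.sum_comp (fun u => kroneckerMap (fun x y => x * y) (M u) (φ u))]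
    exact traceNorm_le_of_traceBounded h

theorem exists_deFinetti_choi {A X Y : Type*} [Fintype A] [Fintype X] [Fintype Y]
    [DecidableEq A] [DecidableEq X] [DecidableEq Y] [Nonempty A] [Nonempty X] [Nonempty Y]
    {n m m' : ℕ} (hm : 0 < m) (hm' : 0 < m') (hn : m + m' = n) (i : Fin n)
    {Q : Matrix (A × (Fin n → X)) (A × (Fin n → X)) ℂ →ₗ[ℂ] Matrix (Fin n → Y) (Fin n → Y) ℂ}
    (hQ : IsChannel Q) (hsym : IsSymmetricMap Q) :
    ∃ (N : ℕ) (M : Fin N → Matrix A A ℂ) (φ : Fin N → Matrix (X × Y) (X × Y) ℂ),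
      (∀ u, (M u).PosSemidef) ∧ ∑ u, M u = (Fintype.card A : ℂ)⁻¹ • 1 ∧ (∀ u, IsState (φ u)) ∧
      (∀ u, trRight (φ u) = (Fintype.card X : ℂ)⁻¹ • (1 : Matrix X X ℂ)) ∧
      TraceBounded (keepAXY i (choi Q) - ∑ u, kroneckerMap (fun x y => x * y) (M u) (φ u))
        (deFinettiConst (Fintype.card X) (Fintype.card Y) * √(1 / m + 1 / m')) := by
  have : Nonempty (Fin m) := ⟨⟨0, hm⟩⟩
  have : Nonempty (Fin m') := ⟨⟨0, hm'⟩⟩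
  obtain ⟨E, D, hE, hE1, hDh, hD, hdual⟩ := exists_tomography (X × Y)
  let e : Fin m ⊕ Fin m' ≃ Fin n := finSumFinEquiv.trans (finCongr hn)
  let ω : Matrix (A × (Fin m ⊕ Fin m' → X × Y)) (A × (Fin m ⊕ Fin m' → X × Y)) ℂ :=
    (pairRegisters (choi Q)).submatrix (fun p => (p.1, p.2 ∘ e.symm)) (fun p => (p.1, p.2 ∘ e.symm))
  have hω : ω.PosSemidef := ((posSemidef_choi hQ).submatrix _).submatrix _
  have hperm : ∀ (s : Equiv.Perm (Fin m ⊕ Fin m')) a b a' b',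
      ω (a, b ∘ s) (a', b' ∘ s) = ω (a, b) (a', b') := by
    intro s a b a' b'
    have h := choi_comp_perm hsym ((e.symm.trans s).trans e) a a'
      (fun k => (b (e.symm k)).1) (fun k => (b' (e.symm k)).1)
      (fun k => (b (e.symm k)).2) (fun k => (b' (e.symm k)).2)
    simp only [ω, pairRegisters, submatrix_apply, Function.comp_apply]
    simpa [Function.comp_def] using h
  have hmarg : ∀ a a' (x x' : Fin m ⊕ Fin m' → X), ∑ y : Fin m ⊕ Fin m' → Y,
      ω (a, fun j => (x j, y j)) (a', fun j => (x' j, y j)) =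
        if a = a' ∧ x = x' then
          ((Fintype.card A : ℂ) * (Fintype.card X : ℂ) ^ Fintype.card (Fin m ⊕ Fin m'))⁻¹
        else 0 := by
    intro a a' x x'
    have h := sum_choi hQ (a, x ∘ e.symm) (a', x' ∘ e.symm)
    rw [← (e.arrowCongr (Equiv.refl Y)).sum_comp] at h
    have hx : x ∘ e.symm = x' ∘ e.symm ↔ x = x' :=
      e.symm.surjective.injective_comp_right.eq_iff
    simp only [Prod.mk.injEq, hx] at h
    refine Eq.trans ?_ (h.trans ?_)
    · rfl
    · simp [hn]
  obtain ⟨M, φ, hM, hM1, hφ, hφX, hb⟩ :=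
    exists_deFinetti hω hperm hmarg hE hE1 hDh hD hdual (e.symm i)
  let f := (Fintype.equivFin (Fin m → (X × Y) × (X × Y) × Fin 4)).symm
  refine ⟨_, fun g => M (f g), fun g => φ (f g), fun g => hM _, ?_, fun g => hφ _,
    fun g => hφX _, ?_⟩
  · rw [f.sum_comp, hM1]
  · rw [f.sum_comp (fun u => kroneckerMap (fun x y => x * y) (M u) (φ u))]
    have hk : keepAXY i (choi Q) = of fun p q => contract ω
        (Function.update (fun _ => 1) (e.symm i) (single q.2 p.2 1)) p.1 q.1 := by
      rw [keepAXY_eq_contract]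
      ext p q
      rw [of_apply, of_apply, contract_submatrix]
      congr 1
      funext k
      simp [Function.update_apply]
    rw [hk]
    simpa using hb

theorem deFinettiConst_nonneg (x y : ℕ) : 0 ≤ deFinettiConst x y := by
  rw [deFinettiConst]
  positivity

/-- Both halves have size at least `n / 3`, so the radicand is at most `6 / n ≤ 9 n^(-1/3)`. -/
theorem sqrt_one_div_half_le {n : ℕ} (hn : 2 ≤ n) :
    √(1 / (n / 2 : ℕ) + 1 / (n - n / 2 : ℕ)) ≤ 3 * (n : ℝ) ^ (-(1 / 6) : ℝ) := by
  have hn0 : (0 : ℝ) < n := by positivity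
  have h1 : (n : ℝ) / 3 ≤ (n / 2 : ℕ) := by
    have : n ≤ 3 * (n / 2) := by omega
    have : (n : ℝ) ≤ 3 * (n / 2 : ℕ) := by exact_mod_cast this
    linarith
  have h2 : (n : ℝ) / 3 ≤ (n - n / 2 : ℕ) := by
    have : n ≤ 3 * (n - n / 2) := by omega
    have : (n : ℝ) ≤ 3 * (n - n / 2 : ℕ) := by exact_mod_cast this
    linarith
  have h3 : (n : ℝ)⁻¹ ≤ (n : ℝ) ^ (-(1 / 3) : ℝ) := by
    rw [← Real.rpow_neg_one]
    exact Real.rpow_le_rpow_of_exponent_le (by exact_mod_cast hn.trans' one_le_two) (by norm_num)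
  have h4 : ((n : ℝ) ^ (-(1 / 6) : ℝ)) ^ 2 = (n : ℝ) ^ (-(1 / 3) : ℝ) := by
    rw [← Real.rpow_natCast, ← Real.rpow_mul hn0.le]
    norm_num
  refine Real.sqrt_le_iff.2 ⟨by positivity, ?_⟩
  rw [mul_pow, h4]
  have h5 : (1 : ℝ) / (n / 2 : ℕ) ≤ 3 * (n : ℝ)⁻¹ := by
    refine (one_div_le_one_div_of_le (by positivity) h1).trans (le_of_eq ?_)
    field_simp
  have h6 : (1 : ℝ) / (n - n / 2 : ℕ) ≤ 3 * (n : ℝ)⁻¹ := by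
    refine (one_div_le_one_div_of_le (by positivity) h2).trans (le_of_eq ?_)
    field_simp
  have : (0 : ℝ) ≤ (n : ℝ)⁻¹ := by positivity
  linarith

end QLearn

theorem mainTheorem3 :
    ∃ c K : ℕ → ℕ → ℝ,
      ∀ (A X Y : Type*) [Fintype A] [Fintype X] [Fintype Y]
        [DecidableEq A] [DecidableEq X] [DecidableEq Y] [Nonempty A] [Nonempty X] [Nonempty Y]
        (n : ℕ) (hn : 0 < n)
        (Q : Matrix (A × (Fin n → X)) (A × (Fin n → X)) ℂ →ₗ[ℂ]
          Matrix (Fin n → Y) (Fin n → Y) ℂ),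
        QLearn.IsChannel Q → QLearn.IsNonSignalling Q → QLearn.IsSymmetricMap Q →
        ∃ (G : Type) (_ : MeasurableSpace G)
          (M : MeasureTheory.VectorMeasure G (Matrix A A ℂ))
          (φ : G → Matrix (X × Y) (X × Y) ℂ),
          QLearn.IsPOVM ((Fintype.card A : ℂ) • M) ∧
          (∀ p q, Measurable fun g => φ g p q) ∧
          (∀ g, QLearn.IsState (φ g)) ∧
          (∀ g, QLearn.trRight (φ g) = (Fintype.card X : ℂ)⁻¹ • (1 : Matrix X X ℂ)) ∧
          (∀ g, ∃ Φ : Matrix X X ℂ →ₗ[ℂ] Matrix Y Y ℂ,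
            QLearn.IsChannel Φ ∧ QLearn.choi Φ = φ g) ∧
          QLearn.IsSeparableState (QLearn.tensorIntegral M φ) ∧
          QLearn.traceNorm
              (QLearn.keepAXY ⟨0, hn⟩ (QLearn.choi Q) - QLearn.tensorIntegral M φ) ≤
            c (Fintype.card X) (Fintype.card Y) * (n : ℝ) ^ (-(1 / 6) : ℝ) +
              K (Fintype.card X) (Fintype.card Y) * (n : ℝ) ^ (-(1 / 3) : ℝ) := by
  -- The factor `3` comes from `sqrt_one_div_half_le` and the `2` pays for `n = 1`; no second-order
  -- term is needed.
  refine ⟨fun x y => 3 * QLearn.deFinettiConst x y + 2, fun _ _ => 0, ?_⟩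
  intro A X Y _ _ _ _ _ _ _ _ _ n hn Q hQ _ hsym
  have hC := QLearn.deFinettiConst_nonneg (Fintype.card X) (Fintype.card Y)
  have hpow : (0 : ℝ) ≤ (n : ℝ) ^ (-(1 / 6) : ℝ) := by positivity
  rcases Nat.lt_or_ge n 2 with h | h
  -- A single register cannot be split into two nonempty blocks. The maximally mixed product
  -- suffices, as two states are at trace distance at most `2`.
  · obtain rfl : n = 1 := by omega
    have hA : ((Fintype.card A : ℂ)⁻¹ • (1 : Matrix A A ℂ)).PosSemidef :=
      Matrix.PosSemidef.one.smul (by positivity)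
    have hX : ((Fintype.card X : ℂ)⁻¹ • (1 : Matrix X X ℂ)).PosSemidef :=
      Matrix.PosSemidef.one.smul (by positivity)
    have hY : ((Fintype.card Y : ℂ)⁻¹ • (1 : Matrix Y Y ℂ)).PosSemidef :=
      Matrix.PosSemidef.one.smul (by positivity)
    have hφ : QLearn.IsState (Matrix.kroneckerMap (fun x y => x * y)
        ((Fintype.card X : ℂ)⁻¹ • (1 : Matrix X X ℂ))
        ((Fintype.card Y : ℂ)⁻¹ • (1 : Matrix Y Y ℂ))) :=
      ⟨hX.kronecker hY, by
        rw [Matrix.trace_kronecker]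
        simp [Matrix.trace_smul]⟩
    refine QLearn.exists_measure_of_traceBounded (ι := Unit)
      (fun _ => hA) (by simp) (fun _ => hφ) (fun _ => ?_)
      (QLearn.TraceBounded.mono (QLearn.IsState.traceBounded_sub
        ⟨QLearn.posSemidef_keepAXY _ (QLearn.posSemidef_choi hQ), ?_⟩ ⟨?_, ?_⟩) ?_)
    · rw [QLearn.trRight_kronecker]
      simp [Matrix.trace_smul]
    · rw [QLearn.trace_keepAXY, QLearn.trace_choi hQ]
    · simpa using hA.kronecker hφ.1
    · simp only [Finset.univ_unique, Finset.sum_singleton]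
      rw [Matrix.trace_kronecker, hφ.2]
      simp [Matrix.trace_smul]
    · simp
      linarith
  · obtain ⟨N, M, φ, hM, hM1, hφ, hφX, hb⟩ := QLearn.exists_deFinetti_choi
      (m := n / 2) (m' := n - n / 2) (by omega) (by omega) (by omega) ⟨0, hn⟩ hQ hsym
    refine QLearn.exists_measure_of_traceBounded hM hM1 hφ hφX (hb.mono ?_)
    have := mul_le_mul_of_nonneg_left (QLearn.sqrt_one_div_half_le h) hC
    simp only
    nlinarith
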